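/- **Setting.** Let $(X,d)$ be a metric space of finite diameter without isolated points, and let $\Gamma$ be a countable group acting on $X$ by homeomorphisms. Distances and diameters of subsets are taken with respect to $d$; "$U,V$ have distance at least $\nu$" means $d(u,v)\ge \nu$ for all $u\in U,v\in V$. *Weakly hyperbolic:* for every $\epsilon>0$ there is $b\in(0,1)$ such that, whenever $x,y\in X$ and $g\in\Gamma$ satisfy $d(x,y)\ge 2\epsilon$ and $d(gx,gy)\ge 2\epsilon$, and $z\in X\setminus\{x,y\}$ satisfies $\min\{d(gz,gx),d(gz,gy)\}\ge\epsilon$, then $d(gw,gx)\le d(z,y)^b/b$ for all $w$ with $d(w,x)\le\epsilon$. *Metrically proper on triples:* for every $\nu\in(0,\frac12)$ there are constants $m(\nu)>0$ and $R(\nu)>-\log(\nu/4)$ such that for all open $U,V\subset X$ of distance at least $\nu$ and of diameter at most $e^{-R(\nu)}$: (i) if $W\subset X$ has diameter at most $e^{-R(\nu)}$ and distance at least $\nu$ from $U\cup V$, then for all $k\in\mathbb Z$ and all $x_0,y_0\in X$ with $d(x_0,y_0)\ge\nu$ there are at most $m(\nu)$ elements $g\in\Gamma$ such that $g(U\times V\times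 W)$ contains a point $(x_0,y_0,z)$ with $e^{-k}\le\min\{d(z,x_0),d(z,y_0)\}\le e^{-k+1}$; (ii) if $U',V'\subset X$ are open, of distance at least $\nu$ and of diameter at most $e^{-R(\nu)}$, and $Z$ (resp. $Z'$) is the set of points whose distance to $U\cup V$ (resp. $U'\cup V'$) is bigger than $\nu$, then there are at most $m(\nu)$ elements $g\in\Gamma$ with $g(U\times V\times Z)\cap (U'\times V'\times Z')\neq\emptyset$. *North-south dynamics* of $g$ with ordered pair of fixed points $(a,b)$, $a\ne b$, $ga=a$, $gb=b$: for every $\epsilon>0$ there is $m>0$ with $g^m(X\setminus B(b,\epsilon))\subset B(a,\epsilon)$ and $g^{-m}(X\setminus B(a,\epsilon))\subset B(b,\epsilon)$, and for some $\delta>0$ one has $\bigcup_{m\in\mathbb Z}g^m(X\setminus (B(a,\delta)\cup B(b,\delta)))=X\setminus\{a,b\}$. **Leaf integrals.** Let $\iota(u,v,w)=(v,u,w)$. An *admissible datum* consists of the following. (1) A number $\nu\in(0,\frac12)$ and constants $m(\nu),R(\nu)$ as above. (2) Open sets $U,V,W\subset X$ pairwise of distance at least $4\nu$, such that $C=U\times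 V\times W$ has diameter less than $e^{-R(\nu)}$ for the sum metric on $X^3$, and such that every $g\in\Gamma$ satisfies $gC=C$ or $g(\overline C\cup\iota\overline C)\cap(\overline C\cup\iota\overline C)=\emptyset$. (3) A Borel probability measure $\mu$ on $W$, positive on nonempty open subsets of $W$ if $W$ is separable (no such measure exists if $W$ is not separable). (4) A Hölder continuous function $\psi:X\times X\to[0,1]$, not identically $0$, vanishing outside $U\times V$. (5) A point $x\in U$. Let $\mathcal H_C$ be the vector space of continuous functions $f$ on the space of triples of pairwise distinct points of $X$ that vanish outside $C$ and are Hölder continuous on $C$ (with some exponent $\alpha\in(0,1)$). The leaf through two points $p\neq q$ is $F(p,q)=\{(p,q,z): z\ne p,q\}$, identified with $X\setminus\{p,q\}$. For $f\in\mathcal H_C$ and a Borel set $E\subset X\setminus\{p,q\}$ put $$I_f(p,q;E)=\frac1{|N|}\sum_{k\in\Gamma}\int_{W\cap k^{-1}E}\Big(\psi(k^{-1}p,k^{-1}q)f(k^{-1}p,k^{-1}q,w)-\psi(k^{-1}q,k^{-1}p)f(k^{-1}q,k^{-1}p,w)\Big)\,d\mu(w),$$ where $N$ is the (finite) group of elements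 of $\Gamma$ fixing $U\cup V\cup W$ pointwise; this is the integral over $E\subset F(p,q)$ of the $\Gamma$-invariant and $\iota$-anti-invariant extension of $f\cdot\psi\mu$ to the leaves. For $g\in\Gamma$ put $\Psi(f)(g)=0$ if $gx=x$, and otherwise $$\Psi(f)(g)=\lim_{r\to0}I_f\big(x,gx;X\setminus(A_r\cup gA_r)\big),\qquad A_r=\{z: d(z,x)\le r\}.$$ A *quasimorphism* is a function $\phi:\Gamma\to\mathbb R$ with $\sup_{g,h}|\phi(g)+\phi(h)-\phi(gh)|<\infty$. It determines the class in $H_b^2(\Gamma,\mathbb R)$ of the bounded homogeneous cocycle $(g,h,u)\mapsto\phi(g^{-1}h)+\phi(h^{-1}u)-\phi(g^{-1}u)$. Here $H^2_b(\Gamma,\mathbb R)$ and $H^2(\Gamma,\mathbb R)$ are the second cohomology groups of the complexes of bounded, respectively arbitrary, $\Gamma$-invariant real functions on the groups $\Gamma^i$, with the homogeneous coboundary operator. **Proposition 3.2.** Let $\Gamma$ be a countable group acting by homeomorphisms on a metric space $X$ of finite diameter without isolated points. Assume that the action is weakly hyperbolic and metrically proper on triples. Suppose that $\Gamma$ contains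 a free subgroup $G$ of rank $2$ such that every $e\ne g\in G$ acts with north-south dynamics on $X$, and that there are infinitely many elements $g_i\in G$ $(i>0)$, with ordered pairs of fixed points $(a_i,b_i)$, such that the $\Gamma$-orbits of the ordered pairs $(a_i,b_i),(b_j,a_j)$ $(i,j>0)$ are pairwise disjoint. Then there are admissible data $D_i$ $(i\in\mathbb N)$, with boxes $C_i$, such that for every $i$ and every $f\in\mathcal H_{C_i}$ the sums defining the integrals $I_f\big(x,gx;X\setminus(A_r\cup gA_r)\big)$ ($gx\ne x$, $r>0$) converge absolutely, the limits defining $\Psi_{D_i}(f)$ exist, and $\Psi_{D_i}(f)$ is a quasimorphism depending linearly on $f$; and the classes of the quasimorphisms $\Psi_{D_i}(f)$ $(i\in\mathbb N,\ f\in\mathcal H_{C_i})$ span an infinite dimensional subspace of $H_b^2(\Gamma,\mathbb R)$, which is contained in the kernel of $H_b^2(\Gamma,\mathbb R)\to H^2(\Gamma,\mathbb R)$. -/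

import Mathlib

open Set Filter Topology MeasureTheory
open scoped NNReal

noncomputable section

namespace LeafQuasi

/-! ### Second bounded cohomology, ordinary second cohomology, and quasimorphisms -/

section Cohomology

variable (Γ : Type*) [Group Γ]

/-- The homogeneous coboundary operator, from functions of `n` variables to functions of `n + 1`
variables: `(d c)(t₀, …, tₙ) = ∑ᵢ (-1)ⁱ c(t₀, …, t̂ᵢ, …, tₙ)`. -/
def coboundary (n : ℕ) : ((Fin n → Γ) → ℝ) →ₗ[ℝ] ((Fin (n + 1) → Γ) → ℝ) where
  toFun c := fun t => ∑ i : Fin (n + 1), (-1 : ℝ) ^ (i : ℕ) * c (fun j => t (i.succAbove j))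
  map_add' c c' := by
    funext t
    simp [mul_add, Finset.sum_add_distrib]
  map_smul' a c := by
    funext t
    simp only [Pi.smul_apply, smul_eq_mul, RingHom.id_apply, Finset.mul_sum]
    exact Finset.sum_congr rfl fun i _ => by ring

/-- Invariant functions `Γⁿ → ℝ` (homogeneous cochains of degree `n - 1`, trivial coefficients). -/
def cochains (n : ℕ) : Submodule ℝ ((Fin n → Γ) → ℝ) where
  carrier := {c | ∀ (g : Γ) (t : Fin n → Γ), c (fun i => g * t i) = c t}
  add_mem' {c c'} hc hc' g t := by simp [hc g t, hc' g t]
  zero_mem' _ _ := rfl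
  smul_mem' a c hc g t := by simp [hc g t]

/-- Bounded invariant functions `Γⁿ → ℝ`, that is, `L^∞(Γⁿ, ℝ)^Γ`. -/
def bddCochains (n : ℕ) : Submodule ℝ ((Fin n → Γ) → ℝ) where
  carrier := {c | c ∈ cochains Γ n ∧ ∃ M : ℝ, ∀ t, |c t| ≤ M}
  add_mem' {c c'} hc hc' := by
    obtain ⟨h, M, hM⟩ := hc
    obtain ⟨h', M', hM'⟩ := hc'
    exact ⟨add_mem h h', M + M', fun t => (abs_add_le _ _).trans (add_le_add (hM t) (hM' t))⟩
  zero_mem' := ⟨zero_mem _, 0, fun t => by simp⟩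
  smul_mem' a c hc := by
    obtain ⟨h, M, hM⟩ := hc
    refine ⟨Submodule.smul_mem _ a h, |a| * M, fun t => ?_⟩
    simpa [abs_mul] using mul_le_mul_of_nonneg_left (hM t) (abs_nonneg a)

/-- Homogeneous 2-cocycles. -/
def cocycles2 : Submodule ℝ ((Fin 3 → Γ) → ℝ) :=
  cochains Γ 3 ⊓ LinearMap.ker (coboundary Γ 3)

/-- Homogeneous 2-coboundaries. -/
def coboundaries2 : Submodule ℝ ((Fin 3 → Γ) → ℝ) :=
  (cochains Γ 2).map (coboundary Γ 2)

/-- Bounded homogeneous 2-cocycles. -/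
def bddCocycles2 : Submodule ℝ ((Fin 3 → Γ) → ℝ) :=
  bddCochains Γ 3 ⊓ LinearMap.ker (coboundary Γ 3)

/-- Coboundaries of bounded homogeneous 1-cochains. -/
def bddCoboundaries2 : Submodule ℝ ((Fin 3 → Γ) → ℝ) :=
  (bddCochains Γ 2).map (coboundary Γ 2)

/-- `H²(Γ, ℝ)`. -/
abbrev H2 : Type _ := ↥(cocycles2 Γ) ⧸ (coboundaries2 Γ).submoduleOf (cocycles2 Γ)

/-- `H_b²(Γ, ℝ)`. -/
abbrev Hb2 : Type _ := ↥(bddCocycles2 Γ) ⧸ (bddCoboundaries2 Γ).submoduleOf (bddCocycles2 Γ)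

theorem bddCocycles2_le : bddCocycles2 Γ ≤ cocycles2 Γ := fun _ hc => ⟨hc.1.1, hc.2⟩

/-- The natural map `H_b²(Γ, ℝ) → H²(Γ, ℝ)`. -/
def comparison : Hb2 Γ →ₗ[ℝ] H2 Γ :=
  Submodule.mapQ _ _ (Submodule.inclusion (bddCocycles2_le Γ)) (by
    rintro ⟨c, hc⟩ ⟨e, he, rfl⟩
    exact ⟨e, he.1, rfl⟩)

/-- The vector space of all quasimorphisms of `Γ`. -/
def quasimorphisms : Submodule ℝ (Γ → ℝ) where
  carrier := {φ | ∃ M : ℝ, ∀ g h : Γ, |φ g + φ h - φ (g * h)| ≤ M}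
  add_mem' {φ φ'} hφ hφ' := by
    obtain ⟨M, hM⟩ := hφ
    obtain ⟨M', hM'⟩ := hφ'
    refine ⟨M + M', fun g h => ?_⟩
    have := (abs_add_le (φ g + φ h - φ (g * h)) (φ' g + φ' h - φ' (g * h))).trans
      (add_le_add (hM g h) (hM' g h))
    refine le_trans (le_of_eq ?_) this
    simp only [Pi.add_apply]
    congr 1
    ring
  zero_mem' := ⟨0, fun g h => by simp⟩
  smul_mem' a φ hφ := by
    obtain ⟨M, hM⟩ := hφ
    refine ⟨|a| * M, fun g h => ?_⟩
    have := mul_le_mul_of_nonneg_left (hM g h) (abs_nonneg a)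
    rw [← abs_mul] at this
    refine le_trans (le_of_eq ?_) this
    simp only [Pi.smul_apply, smul_eq_mul]
    congr 1
    ring

/-- The bounded 2-cocycle `(g, h, u) ↦ φ(g⁻¹h) + φ(h⁻¹u) - φ(g⁻¹u)` of a quasimorphism `φ`. -/
def qmCocycle : quasimorphisms Γ →ₗ[ℝ] bddCocycles2 Γ where
  toFun φ := ⟨fun t => φ.1 ((t 0)⁻¹ * t 1) + φ.1 ((t 1)⁻¹ * t 2) - φ.1 ((t 0)⁻¹ * t 2), by
    obtain ⟨φ, M, hM⟩ := φ
    refine ⟨⟨fun g t => ?_, M, fun t => ?_⟩, ?_⟩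
    · simp [mul_assoc]
    · have := hM ((t 0)⁻¹ * t 1) ((t 1)⁻¹ * t 2)
      simpa [mul_assoc] using this
    · change coboundary Γ 3 _ = 0
      funext t
      simp [coboundary, Fin.sum_univ_succ, Fin.succAbove, Fin.lt_def]
      ring⟩
  map_add' φ φ' := by
    ext t
    simp
    ring
  map_smul' a φ := by
    ext t
    simp
    ring

/-- The class in `H_b²(Γ, ℝ)` of a quasimorphism. -/
def qmClass : quasimorphisms Γ →ₗ[ℝ] Hb2 Γ :=
  (Submodule.mkQ _).comp (qmCocycle Γ)

end Cohomology

/-! ### Dynamical conditions on the action -/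

section Dynamics

variable (Γ X : Type*) [Group Γ] [MetricSpace X] [MulAction Γ X]

/-- The two requirements in the definition of a metrically proper action on triples of pairwise
distinct points, for one value of `ν` and with the constants `m = m(ν)` and `R = R(ν)`. -/
def ProperAt (ν : ℝ) (m : ℕ) (R : ℝ) : Prop :=
  ∀ U V : Set X, IsOpen U → IsOpen V → (∀ u ∈ U, ∀ v ∈ V, ν ≤ dist u v) →
    Metric.diam U ≤ Real.exp (-R) → Metric.diam V ≤ Real.exp (-R) →
    (∀ W : Set X, Metric.diam W ≤ Real.exp (-R) → (∀ w ∈ W, ∀ u ∈ U ∪ V, ν ≤ dist w u) →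
      ∀ (k : ℤ) (x₀ y₀ : X), ν ≤ dist x₀ y₀ →
        {g : Γ | ∃ u ∈ U, ∃ v ∈ V, ∃ w ∈ W, g • u = x₀ ∧ g • v = y₀ ∧
          Real.exp (-k) ≤ min (dist (g • w) x₀) (dist (g • w) y₀) ∧
          min (dist (g • w) x₀) (dist (g • w) y₀) ≤ Real.exp (-k + 1)}.encard ≤ m) ∧
    (∀ U' V' : Set X, IsOpen U' → IsOpen V' → (∀ u ∈ U', ∀ v ∈ V', ν ≤ dist u v) →
      Metric.diam U' ≤ Real.exp (-R) → Metric.diam V' ≤ Real.exp (-R) →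
        {g : Γ | ∃ u ∈ U, ∃ v ∈ V, ∃ z : X, ν < Metric.infDist z (U ∪ V) ∧
          g • u ∈ U' ∧ g • v ∈ V' ∧ ν < Metric.infDist (g • z) (U' ∪ V')}.encard ≤ m)

/-- The pair `(m, R)` consists of admissible constants `m(ν) > 0`, `R(ν) > - log (ν / 4)`. -/
def IsProperConstants (ν : ℝ) (m : ℕ) (R : ℝ) : Prop :=
  0 < m ∧ -Real.log (ν / 4) < R ∧ ProperAt Γ X ν m R

/-- The action of `Γ` on triples of pairwise distinct points of `X` is metrically proper. -/
def MetricallyProper : Prop :=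
  ∀ ν : ℝ, 0 < ν → ν < 1 / 2 → ∃ (m : ℕ) (R : ℝ), IsProperConstants Γ X ν m R

/-- Weakly hyperbolic actions. -/
def WeaklyHyperbolic : Prop :=
  ∀ ε : ℝ, 0 < ε → ∃ b : ℝ, 0 < b ∧ b < 1 ∧
    ∀ (x y : X) (g : Γ), 2 * ε ≤ dist x y → 2 * ε ≤ dist (g • x) (g • y) →
      ∀ z : X, z ≠ x → z ≠ y → ε ≤ min (dist (g • z) (g • x)) (dist (g • z) (g • y)) →
        ∀ w : X, dist w x ≤ ε → dist (g • w) (g • x) ≤ dist z y ^ b / b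

variable {Γ X}

/-- `g` acts with north-south dynamics, with attracting fixed point `a` and repelling fixed
point `b`; thus `(a, b)` is the ordered pair of fixed points of `g`. -/
def NorthSouth (g : Γ) (a b : X) : Prop :=
  a ≠ b ∧ g • a = a ∧ g • b = b ∧
  (∀ ε : ℝ, 0 < ε → ∃ m : ℕ, 0 < m ∧
    (∀ z : X, z ∉ Metric.ball b ε → g ^ m • z ∈ Metric.ball a ε) ∧
    (∀ z : X, z ∉ Metric.ball a ε → (g ^ m)⁻¹ • z ∈ Metric.ball b ε)) ∧
  (∃ δ : ℝ, 0 < δ ∧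
    (⋃ m : ℤ, (fun z : X => g ^ m • z) '' (Metric.ball a δ ∪ Metric.ball b δ)ᶜ) = {a, b}ᶜ)

end Dynamics

/-! ### Integration of Hölder functions over leaves -/

section Leaves

/-- The involution `ι (u, v, w) = (v, u, w)` on triples. -/
def tripleFlip {X : Type*} (p : X × X × X) : X × X × X := (p.2.1, p.1, p.2.2)

/-- The union of the closure of a set `C` of triples and of its image under `ι`. -/
def flipHull {X : Type*} [TopologicalSpace X] (C : Set (X × X × X)) : Set (X × X × X) :=
  closure C ∪ tripleFlip '' closure C

/-- The data for the construction: a box `C = U × V × W` in the space of triples, the measure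
`μ = μ_W` on the factor `W`, the transverse weight `ψ` and the base point `x ∈ U`. -/
structure LeafDatum (Γ X : Type*) [Group Γ] [MetricSpace X] [MulAction Γ X]
    [MeasurableSpace X] where
  ν : ℝ
  m : ℕ
  R : ℝ
  ν_pos : 0 < ν
  ν_lt : ν < 1 / 2
  constants : IsProperConstants Γ X ν m R
  U : Set X
  V : Set X
  W : Set X
  isOpen_U : IsOpen U
  isOpen_V : IsOpen V
  isOpen_W : IsOpen W
  sep_UV : ∀ u ∈ U, ∀ v ∈ V, 4 * ν ≤ dist u v
  sep_UW : ∀ u ∈ U, ∀ w ∈ W, 4 * ν ≤ dist u w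
  sep_VW : ∀ v ∈ V, ∀ w ∈ W, 4 * ν ≤ dist v w
  /-- The diameter of `U × V × W` for the sum metric is less than `e^{-R}`. -/
  diam_lt : Metric.diam U + Metric.diam V + Metric.diam W < Real.exp (-R)
  /-- Every `g` maps `C` onto itself or moves `C ∪ ι C`, closed up, off itself; so the closure of
  `C`, modulo the (finite) stabilizer of `C`, embeds into the quotient of the space of triples by
  `Γ` and `ι`. -/
  embeds : ∀ g : Γ, (fun p : X × X × X => g • p) '' (U ×ˢ V ×ˢ W) = U ×ˢ V ×ˢ W ∨
    Disjoint ((fun p : X × X × X => g • p) '' flipHull (U ×ˢ V ×ˢ W)) (flipHull (U ×ˢ V ×ˢ W))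
  μ : Measure X
  prob : IsProbabilityMeasure μ
  μ_compl : μ Wᶜ = 0
  /-- Positivity on open sets. On a non-separable `W` no Borel probability measure is positive on
  all nonempty open subsets, so nothing is required there. -/
  μ_open : TopologicalSpace.IsSeparable W →
    ∀ O : Set X, O ⊆ W → IsOpen O → O.Nonempty → 0 < μ O
  ψ : X × X → ℝ
  ψ_mem : ∀ p, ψ p ∈ Icc (0 : ℝ) 1
  ψ_supp : ∀ p, p ∉ U ×ˢ V → ψ p = 0
  ψ_ne : ψ ≠ 0
  ψ_holder : ∃ q α : ℝ≥0, 0 < α ∧ α < 1 ∧ HolderWith q α ψ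
  x : X
  x_mem : x ∈ U

namespace LeafDatum

variable {Γ X : Type*} [Group Γ] [MetricSpace X] [MulAction Γ X] [MeasurableSpace X]

/-- The box `C = U × V × W`. -/
def C (D : LeafDatum Γ X) : Set (X × X × X) := D.U ×ˢ D.V ×ˢ D.W

/-- The space `H_C` of Hölder continuous functions supported in `C`, extended by zero. (The
maximum metric used by `HolderOnWith` on the product and the sum metric are bi-Lipschitz.) -/
def holderFunctions [BoundedSpace X] (D : LeafDatum Γ X) : Submodule ℝ (X × X × X → ℝ) where
  carrier := {f | Continuous f ∧ (∀ p, p ∉ D.C → f p = 0) ∧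
    ∃ q α : ℝ≥0, 0 < α ∧ α < 1 ∧ HolderOnWith q α f D.C}
  add_mem' {f g} hf hg := by
    obtain ⟨cf, sf, q, α, h0, h1, hf⟩ := hf
    obtain ⟨cg, sg, q', α', h0', h1', hg⟩ := hg
    refine ⟨cf.add cg, fun p hp => by simp [sf p hp, sg p hp], ?_⟩
    obtain ⟨B, hB⟩ := (Metric.isBounded_iff_nndist).1
      (BoundedSpace.bounded_univ (α := X × X × X))
    have hB' : ∀ p ∈ D.C, ∀ p' ∈ D.C, edist p p' ≤ B := fun p _ p' _ => by
      rw [edist_nndist]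
      exact_mod_cast hB (mem_univ p) (mem_univ p')
    have e1 := HolderWith.restrict_iff.2 (hf.of_le hB' (min_le_left α α'))
    have e2 := HolderWith.restrict_iff.2 (hg.of_le hB' (min_le_right α α'))
    exact ⟨_, min α α', lt_min h0 h0', (min_le_left _ _).trans_lt h1,
      HolderWith.restrict_iff.1 (e1.add e2)⟩
  zero_mem' := ⟨continuous_const, fun _ _ => rfl, 0, 1 / 2, by norm_num,
    NNReal.half_lt_self one_ne_zero, (HolderWith.zero).holderOnWith _⟩
  smul_mem' a f hf := by
    obtain ⟨cf, sf, q, α, h0, h1, hf⟩ := hf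
    refine ⟨continuous_const.mul cf, fun p hp => by simp [sf p hp], ?_⟩
    exact ⟨_, α, h0, h1, HolderWith.restrict_iff.1 ((HolderWith.restrict_iff.2 hf).smul a)⟩

/-- The contribution of the translate `k (C ∪ ι C)` to the integral of `f` over the part `E` of
the leaf `F(p, q) = {(p, q, z) | z ≠ p, q}`: the function `f`,
together with the leaf measure `ψ(u, v) μ` on `{(u, v)} × W`, is transported by `k`, and it enters
with the opposite sign on `k (ι C)`. -/
def piece (D : LeafDatum Γ X) (f : X × X × X → ℝ) (p q : X) (E : Set X) (k : Γ) : ℝ :=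
  ∫ w in {w : X | k • w ∈ E},
    (D.ψ (k⁻¹ • p, k⁻¹ • q) * f (k⁻¹ • p, k⁻¹ • q, w) -
      D.ψ (k⁻¹ • q, k⁻¹ • p) * f (k⁻¹ • q, k⁻¹ • p, w)) ∂D.μ

/-- The integral over the part `E` of the leaf `F(p, q)` of the `Γ`-invariant, `ι`-anti-invariant
leafwise extension of `f`. The sum runs over `Γ`, so it is divided by the order of the (finite)
group of elements fixing `C` pointwise. -/
def leafIntegral (D : LeafDatum Γ X) (f : X × X × X → ℝ) (p q : X) (E : Set X) : ℝ :=
  (Nat.card (fixingSubgroup Γ (D.U ∪ D.V ∪ D.W)) : ℝ)⁻¹ * ∑' k : Γ, D.piece f p q E k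

/-- The complement of `A ∪ gA`, where `A` is the closed ball of radius `r` about the base point. -/
def region (D : LeafDatum Γ X) (g : Γ) (r : ℝ) : Set X :=
  (Metric.closedBall D.x r ∪ (fun z : X => g • z) '' Metric.closedBall D.x r)ᶜ

/-- `φ` is the function `Ψ(f)`: it vanishes on the stabilizer of the base point `x`, and for
`g x ≠ x` the number `φ g` is the limit, as the ball `A` about `x` shrinks to `x`, of the
(absolutely convergent) integrals of `f` over `F(x, gx) - A - gA`. -/
def IsPsi (D : LeafDatum Γ X) (f : X × X × X → ℝ) (φ : Γ → ℝ) : Prop :=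
  ∀ g : Γ, (g • D.x = D.x → φ g = 0) ∧
    (g • D.x ≠ D.x →
      (∀ r : ℝ, 0 < r → Summable (D.piece f D.x (g • D.x) (D.region g r))) ∧
      Tendsto (fun r : ℝ => D.leafIntegral f D.x (g • D.x) (D.region g r)) (𝓝[>] 0) (𝓝 (φ g)))

end LeafDatum

end Leaves

end LeafQuasi

end

/-!
Write `H u v` for the function `w ↦ ψ (u, v) f (u, v, w)`, which is Hölder in `(u, v)` and vanishes
outside `U × V`. The translate `k (C ∪ ι C)` contributes the integral of
`legTerm H k p q = H (k⁻¹ p) (k⁻¹ q) - H (k⁻¹ q) (k⁻¹ p)` to the leaf through `p` and `q`. The core of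
the argument is `HyperbolicBox.exists_sum_triTerm_le`: for all `p, q, s` the sums of the three
contributions of `k` to the sides of the triangle are absolutely summable over `k`, with a bound
independent of the triangle. Indeed, if `(k⁻¹ p, k⁻¹ q) ∈ U × V`, then for all but boundedly many `k`
the point `k⁻¹ s` is close to `U` or to `V`; if it is close to `V`, the three contributions
reduce to `H (k⁻¹ p) (k⁻¹ q) - H (k⁻¹ p) (k⁻¹ s)`, which the Hölder condition bounds by a power of the
distance of `k⁻¹ q` and `k⁻¹ s`. These distances are summable because the number of `k` for which
the distance is at least `e⁻ⁿ` grows at most linearly in `n` (`HyperbolicBox.exists_card_le`). This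
count combines the contraction property, the properness condition on annuli, and the absence of
isolated points.

The sum over a single leaf need not converge near its ends. The base point `x` is therefore chosen
with a partner `y` such that the leaf through `x` and `y` misses all translates of the box. Comparing
the leaf through `x` and `g x` with that leaf shows that its contributions are absolutely summable
(`HyperbolicBox.summable_legTerm_orbit`). So `Ψ(f)(g)` is an honest sum, and the bound for triangles
says that it is a quasimorphism (`LeafDatum.exists_psi`). The choice of `x` also
makes the prescribed value `0` on the stabilizer of `x` harmless.

On the powers of an element `h` with fixed points `a, b`, the quasimorphism is, up to a bounded error,
minus the sum over the part of the leaf through `a` and `b` between a neighbourhood of `a` and its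
image under `hⁿ` (`HyperbolicBox.exists_norm_tsum_add_le`). It is bounded if that leaf misses
all translates of the box, and grows linearly if the box is crossed in one direction only. Orbits of
pairs of fixed points are closed (`exists_orbit_avoid`), so the `i`-th box can be placed on the leaf of
`g i` so as to be missed by the leaves of `g j` for `j < i` and `j = i + 1`; a fixed point of `g (i + 1)`,
moved by a power of `g i`, serves as the base point. The resulting quasimorphisms form a triangular
system on the powers of the `g i`. A relation between their classes is a homomorphism up to a bounded
function, and homomorphisms from the free group `G` to the real line form a plane, so the span of
the classes is infinite dimensional (`not_finiteDimensional_of_qmClass_mem`).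
-/

open scoped BoundedContinuousFunction

noncomputable section

namespace LeafQuasi

/-! ### Counting returns to a small box -/

section Box

variable {Γ X : Type*} [Group Γ] [MetricSpace X] [MulAction Γ X]

/-- The metric properties of a pair of small sets `U`, `V` and a point `o` (in the third factor of
a box) on which all estimates rest. The numbers `ε` and `b` are those of weak hyperbolicity, `ν` and
`m` those of metric properness. The fields `annulus` and `far` are the two properness conditions,
specialised to `U × V × {o}` and to `U' × V' = U × V`. The fields `inner_U` and `inner_V` provide
points that are at most `ε` away from `U`, respectively `V`, but bounded away from it; they exist
about any point that is not isolated, once `U` and `V` are small. -/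
structure HyperbolicBox (Γ : Type*) {X : Type*} [Group Γ] [MetricSpace X] [MulAction Γ X]
    (U V : Set X) (o : X) (ε b ν : ℝ) (m : ℕ) : Prop where
  ε_pos : 0 < ε
  ε_le_one : ε ≤ 1
  b_pos : 0 < b
  contract : ∀ (x y : X) (g : Γ), 2 * ε ≤ dist x y → 2 * ε ≤ dist (g • x) (g • y) →
    ∀ z : X, z ≠ x → z ≠ y → ε ≤ min (dist (g • z) (g • x)) (dist (g • z) (g • y)) →
      ∀ w : X, dist w x ≤ ε → dist (g • w) (g • x) ≤ dist z y ^ b / b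
  ν_pos : 0 < ν
  ν_le : 3 * ν ≤ ε
  sep_UV : ∀ u ∈ U, ∀ v ∈ V, 2 * ε ≤ dist u v
  sep_U : ∀ u ∈ U, ε ≤ dist o u
  sep_V : ∀ v ∈ V, ε ≤ dist o v
  small_U : ∀ u ∈ U, ∀ u' ∈ U, dist u u' ≤ ν
  small_V : ∀ v ∈ V, ∀ v' ∈ V, dist v v' ≤ ν
  annulus : ∀ (j : ℤ), ∀ x₀ ∈ U, ∀ y₀ ∈ V,
    {g : Γ | g⁻¹ • x₀ ∈ U ∧ g⁻¹ • y₀ ∈ V ∧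
      Real.exp (-j) ≤ min (dist (g • o) x₀) (dist (g • o) y₀) ∧
      min (dist (g • o) x₀) (dist (g • o) y₀) ≤ Real.exp (-j + 1)}.encard ≤ m
  far : {g : Γ | ∃ u ∈ U, ∃ v ∈ V, ∃ z : X, ν < Metric.infDist z (U ∪ V) ∧
    g • u ∈ U ∧ g • v ∈ V ∧ ν < Metric.infDist (g • z) (U ∪ V)}.encard ≤ m
  inner_U : ∃ η : ℝ, 0 < η ∧ ∃ u₀ : X, ∀ u ∈ U, η ≤ dist u₀ u ∧ dist u₀ u ≤ ε
  inner_V : ∃ η : ℝ, 0 < η ∧ ∃ v₀ : X, ∀ v ∈ V, η ≤ dist v₀ v ∧ dist v₀ v ≤ ε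

namespace HyperbolicBox

variable {U V : Set X} {o : X} {ε b ν : ℝ} {m : ℕ}

theorem symm (B : HyperbolicBox Γ U V o ε b ν m) : HyperbolicBox Γ V U o ε b ν m where
  ε_pos := B.ε_pos
  ε_le_one := B.ε_le_one
  b_pos := B.b_pos
  contract := B.contract
  ν_pos := B.ν_pos
  ν_le := B.ν_le
  sep_UV u hu v hv := by rw [dist_comm]; exact B.sep_UV v hv u hu
  sep_U := B.sep_V
  sep_V := B.sep_U
  small_U := B.small_V
  small_V := B.small_U
  annulus j x₀ hx y₀ hy := by
    refine le_trans (encard_le_encard ?_) (B.annulus j y₀ hy x₀ hx)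
    rintro g ⟨h1, h2, h3, h4⟩
    exact ⟨h2, h1, by rwa [min_comm], by rwa [min_comm]⟩
  far := by
    refine le_trans (encard_le_encard ?_) B.far
    rintro g ⟨u, hu, v, hv, z, h1, h2, h3, h4⟩
    exact ⟨v, hv, u, hu, z, by rwa [union_comm], h3, h2, by rwa [union_comm]⟩
  inner_U := B.inner_V
  inner_V := B.inner_U

/-- Elements returning to `U × V` over a given base pair, and carrying `o` outside the
`e⁻ⁿ`-neighbourhoods of that pair, are at most linear in `n` in number. -/
theorem encard_outside_le [BoundedSpace X] (B : HyperbolicBox Γ U V o ε b ν m) :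
    ∃ c : ℕ, ∀ n : ℕ, ∀ x₀ ∈ U, ∀ y₀ ∈ V,
      {g : Γ | g⁻¹ • x₀ ∈ U ∧ g⁻¹ • y₀ ∈ V ∧
        Real.exp (-n) ≤ min (dist (g • o) x₀) (dist (g • o) y₀)}.encard ≤ (m * (n + c) : ℕ) := by
  obtain ⟨K, hK⟩ := Metric.isBounded_iff.1 (BoundedSpace.bounded_univ (α := X))
  obtain ⟨c, hc⟩ := exists_nat_ge (Real.log (max K 1))
  refine ⟨c + 1, fun n x₀ hx y₀ hy => ?_⟩
  have hsub : {g : Γ | g⁻¹ • x₀ ∈ U ∧ g⁻¹ • y₀ ∈ V ∧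
        Real.exp (-n) ≤ min (dist (g • o) x₀) (dist (g • o) y₀)} ⊆
      ⋃ j ∈ Finset.Icc (-(c : ℤ)) n, {g : Γ | g⁻¹ • x₀ ∈ U ∧ g⁻¹ • y₀ ∈ V ∧
      Real.exp (-j) ≤ min (dist (g • o) x₀) (dist (g • o) y₀) ∧
      min (dist (g • o) x₀) (dist (g • o) y₀) ≤ Real.exp (-j + 1)} := by
    rintro g ⟨h1, h2, h3⟩
    set t := min (dist (g • o) x₀) (dist (g • o) y₀) with ht
    have tpos : 0 < t := lt_of_lt_of_le (Real.exp_pos _) h3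
    have htK : Real.log t ≤ c := by
      refine le_trans (Real.log_le_log tpos ?_) hc
      exact le_trans (min_le_left _ _) (le_trans (hK (mem_univ _) (mem_univ _)) (le_max_left _ _))
    have htn : -(n : ℝ) ≤ Real.log t := (Real.le_log_iff_exp_le tpos).2 h3
    simp only [mem_iUnion, mem_ofPred_eq, Finset.mem_Icc]
    refine ⟨⌈-Real.log t⌉, ⟨?_, ?_⟩, h1, h2, ?_, ?_⟩
    · have : (-(c : ℤ) : ℝ) ≤ ⌈-Real.log t⌉ := le_trans (by push_cast; linarith) (Int.le_ceil _)
      exact_mod_cast this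
    · exact Int.ceil_le.2 (by push_cast; linarith)
    · rw [← Real.le_log_iff_exp_le tpos]
      linarith [Int.le_ceil (-Real.log t)]
    · rw [← Real.log_le_iff_le_exp tpos]
      linarith [Int.ceil_lt_add_one (-Real.log t)]
  refine le_trans (encard_le_encard hsub) (le_trans (Finset.set_encard_biUnion_le _ _) ?_)
  refine le_trans (Finset.sum_le_sum fun j _ => B.annulus j x₀ hx y₀ hy) ?_
  rw [Finset.sum_const, Int.card_Icc, nsmul_eq_mul]
  have : ((n : ℤ) + 1 - -(c : ℤ)).toNat = n + (c + 1) := by omega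
  rw [this, mul_comm m]
  push_cast
  exact le_rfl

theorem contract_at (B : HyperbolicBox Γ U V o ε b ν m) {g : Γ} {u v : X}
    (hu : u ∈ U) (hv : v ∈ V) (hgu : g • u ∈ U) (hgv : g • v ∈ V) {w : X} (hw : dist w v ≤ ε) :
    dist (g • w) (g • v) ≤ dist (g⁻¹ • o) u ^ b / b := by
  have h1 := B.sep_U _ hgu
  have h2 := B.sep_V _ hgv
  have hε := B.ε_pos
  refine B.contract v u g ?_ ?_ (g⁻¹ • o) ?_ ?_ ?_ w hw
  · rw [dist_comm]; exact B.sep_UV u hu v hv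
  · rw [dist_comm]; exact B.sep_UV _ hgu _ hgv
  · rintro rfl
    simp at h2; linarith
  · rintro rfl
    simp at h1; linarith
  · simp only [smul_inv_smul]; exact le_min h2 h1

/-- Two returns cannot lie behind each other. If `o`, transported by `g⁻¹`, is
close to `v`, then `g` contracts a ball about `u`; if `g o` is close to `g v`, then `g⁻¹` contracts
a ball about `g u`. Both together would leave no room for the point `u₀` of `inner_U`. -/
theorem exists_not_both_close (B : HyperbolicBox Γ U V o ε b ν m) :
    ∃ δ : ℝ, 0 < δ ∧ ∀ (g : Γ) (u v : X), u ∈ U → v ∈ V → g • u ∈ U → g • v ∈ V →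
      dist (g⁻¹ • o) v < δ → δ ≤ dist (g • o) (g • v) := by
  obtain ⟨η, hη, u₀, hu₀⟩ := B.inner_U
  have hb := B.b_pos
  have hlim : Tendsto (fun t : ℝ => t ^ b / b) (𝓝 0) (𝓝 0) := by
    have : ContinuousAt (fun t : ℝ => t ^ b / b) 0 :=
      (Real.continuousAt_rpow_const _ _ (Or.inr hb.le)).div_const b
    have h2 := this.tendsto
    simpa [Real.zero_rpow hb.ne'] using h2
  obtain ⟨δ, hδ, hδ'⟩ := Metric.tendsto_nhds_nhds.1 hlim η hη
  have key : ∀ t : ℝ, 0 ≤ t → t < δ → t ^ b / b < η := fun t h0 h1 => by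
    have := hδ' (x := t) (by simpa [abs_of_nonneg h0] using h1)
    rw [Real.dist_eq, sub_zero] at this
    exact lt_of_le_of_lt (le_abs_self _) this
  refine ⟨δ, hδ, fun g u v hu hv hgu hgv h => ?_⟩
  by_contra! h'
  have e1 : dist (g⁻¹ • u₀) (g⁻¹ • g • u) < η := by
    refine lt_of_le_of_lt (B.symm.contract_at (g := g⁻¹) (u := g • v) (v := g • u) (w := u₀)
      hgv hgu (by simpa) (by simpa) (hu₀ _ hgu).2) ?_
    rw [inv_inv]
    exact key _ dist_nonneg h'
  rw [inv_smul_smul] at e1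
  have e2 := B.symm.contract_at (g := g) hv hu hgv hgu
    (le_trans e1.le ((hu₀ u hu).1.trans (hu₀ u hu).2))
  rw [smul_inv_smul] at e2
  exact absurd (hu₀ _ hgu).1 (not_le.2 (lt_of_le_of_lt e2 (key _ dist_nonneg h)))

/-- For a triple `(p, q, s)`, the number of returns `k` of `(p, q)` to `U × V` for which `k⁻¹ s` is
close to `k⁻¹ q`, but not closer than `e⁻ⁿ`, is at most linear in `n`. Seen from any one of these
returns, none of the others is very close to the point in `U` (by contraction), and by
`exists_not_both_close` at least half of the ordered pairs of returns are such that the second is not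
very close to the point in `V` either; so properness bounds the number of pairs. -/
theorem exists_card_le [BoundedSpace X] (B : HyperbolicBox Γ U V o ε b ν m) :
    ∃ C : ℕ, ∀ (p q s : X) (n : ℕ) (F : Finset Γ),
      (∀ k ∈ F, k⁻¹ • p ∈ U ∧ k⁻¹ • q ∈ V ∧ dist (k⁻¹ • s) (k⁻¹ • q) ≤ ε ∧
        Real.exp (-n) ≤ dist (k⁻¹ • s) (k⁻¹ • q)) → F.card ≤ C * (n + 1) := by
  classical
  obtain ⟨c, hc⟩ := B.encard_outside_le
  obtain ⟨δ, hδ, hclose⟩ := B.exists_not_both_close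
  have hb := B.b_pos
  -- `N` is such that `ρ = exp (-N (n + 1))` satisfies both `ρ ≤ δ` and `ρ ^ b / b ≤ exp (-n)`.
  obtain ⟨N, hN⟩ := exists_nat_ge (max (1 / b) (max (-Real.log b / b) (-Real.log δ)))
  have hN1 : 1 ≤ b * N := by
    have := (le_max_left _ _).trans hN
    rwa [div_le_iff₀' hb] at this
  have hN2 : -Real.log b ≤ b * N := by
    have := ((le_max_left _ _).trans (le_max_right _ _)).trans hN
    rwa [div_le_iff₀' hb] at this
  have hN3 : -Real.log δ ≤ N := ((le_max_right _ _).trans (le_max_right _ _)).trans hN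
  refine ⟨2 * m * (N + c), fun p q s n F hF => ?_⟩
  have hn0 : (0 : ℝ) ≤ n := Nat.cast_nonneg n
  have hN0 : (0 : ℝ) ≤ N := Nat.cast_nonneg N
  set ρ : ℝ := Real.exp (-(N * (n + 1) : ℕ)) with hρ
  have hρδ : ρ ≤ δ := by
    rw [hρ, ← Real.le_log_iff_exp_le hδ]
    push_cast
    nlinarith [mul_nonneg hN0 hn0]
  have hρb : ρ ^ b / b ≤ Real.exp (-n) := by
    rw [div_le_iff₀ hb, hρ, ← Real.exp_mul]
    nth_rewrite 2 [← Real.exp_log hb]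
    rw [← Real.exp_add, Real.exp_le_exp]
    push_cast
    nlinarith [mul_le_mul_of_nonneg_right hN1 hn0]
  -- `R k l`: seen from the return `k`, the return `l` is not `ρ`-close to the base pair.
  let R : Γ → Γ → Prop := fun k l => ρ ≤ min (dist ((k⁻¹ * l) • o) (k⁻¹ • p))
    (dist ((k⁻¹ * l) • o) (k⁻¹ • q))
  have hR1 : ∀ k ∈ F, ∀ l ∈ F, ρ ≤ dist ((k⁻¹ * l) • o) (k⁻¹ • p) := by
    intro k hk l hl
    by_contra! hlt
    obtain ⟨h1, h2, h3, -⟩ := hF k hk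
    obtain ⟨h1', h2', -, h4'⟩ := hF l hl
    have := B.contract_at (g := l⁻¹ * k) h1 h2 (by simpa [mul_smul]) (by simpa [mul_smul]) h3
    simp only [mul_smul, smul_inv_smul, mul_inv_rev, inv_inv] at this
    have h5 := Real.rpow_lt_rpow dist_nonneg hlt hb
    simp only [mul_smul] at h5
    have h6 : dist (k⁻¹ • l • o) (k⁻¹ • p) ^ b / b < ρ ^ b / b := by gcongr
    linarith
  have hR2 : ∀ k ∈ F, ∀ l ∈ F, R k l ∨ R l k := by
    intro k hk l hl
    by_contra! hcon
    obtain ⟨n1, n2⟩ := hcon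
    have m1 : dist ((k⁻¹ * l) • o) (k⁻¹ • q) < ρ := by
      by_contra! h
      exact n1 (le_min (hR1 k hk l hl) h)
    have m2 : dist ((l⁻¹ * k) • o) (l⁻¹ • q) < ρ := by
      by_contra! h
      exact n2 (le_min (hR1 l hl k hk) h)
    obtain ⟨h1, h2, -⟩ := hF k hk
    obtain ⟨h1', h2', -⟩ := hF l hl
    have := hclose (l⁻¹ * k) (k⁻¹ • p) (k⁻¹ • q) h1 h2 (by simpa [mul_smul]) (by simpa [mul_smul])
      (by simpa using m1.trans_le hρδ)
    simp only [mul_smul, smul_inv_smul] at this m2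
    linarith
  have hcount : ∀ k ∈ F, (F.filter (R k)).card ≤ m * (N * (n + 1) + c) := by
    intro k hk
    obtain ⟨h1, h2, -⟩ := hF k hk
    have := hc (N * (n + 1)) _ h1 _ h2
    have h3 : (((F.filter (R k)).image (fun l => k⁻¹ * l) : Finset Γ) : Set Γ).encard ≤
        (m * (N * (n + 1) + c) : ℕ) := by
      refine le_trans (encard_le_encard ?_) this
      intro g hg
      simp only [Finset.coe_image, mem_image, Finset.mem_coe, Finset.mem_filter] at hg
      obtain ⟨l, ⟨hl, hRl⟩, rfl⟩ := hg
      obtain ⟨h1', h2', -⟩ := hF l hl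
      exact ⟨by simpa [mul_smul], by simpa [mul_smul], hRl⟩
    rw [encard_coe_eq_coe_finsetCard, Finset.card_image_of_injective _ (mul_right_injective _)] at h3
    exact_mod_cast h3
  have hsq : F.card * F.card ≤ 2 * ∑ k ∈ F, (F.filter (R k)).card := by
    have e : ∀ k ∈ F, ∀ l ∈ F, 1 ≤ (if R k l then 1 else 0) + (if R l k then 1 else 0) := by
      intro k hk l hl
      rcases hR2 k hk l hl with h | h <;> simp [h]
    calc F.card * F.card = ∑ k ∈ F, ∑ l ∈ F, 1 := by simp
      _ ≤ ∑ k ∈ F, ∑ l ∈ F, ((if R k l then 1 else 0) + (if R l k then 1 else 0)) :=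
        Finset.sum_le_sum fun k hk => Finset.sum_le_sum fun l hl => e k hk l hl
      _ = _ := by
        simp only [Finset.sum_add_distrib]
        rw [Finset.sum_comm (f := fun k l => if R l k then 1 else 0)]
        simp only [Finset.card_filter]
        ring
  have hle : F.card * F.card ≤ F.card * (2 * (m * (N * (n + 1) + c))) := by
    refine hsq.trans ?_
    have := Finset.sum_le_card_nsmul F _ _ hcount
    rw [smul_eq_mul] at this
    nlinarith
  rcases Nat.eq_zero_or_pos F.card with h0 | h0
  · simp [h0]
  · have := Nat.le_of_mul_le_mul_left hle h0
    refine this.trans ?_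
    have : N * (n + 1) + c ≤ (N + c) * (n + 1) := by nlinarith [Nat.zero_le (c * n)]
    nlinarith [Nat.mul_le_mul_left (2 * m) this]

/-- The distances between `k⁻¹ s` and `k⁻¹ q`, over the returns `k` of `(p, q)` for which `k⁻¹ s`
is close to `k⁻¹ q`, are uniformly summable to any positive power. -/
theorem exists_sum_rpow_le [BoundedSpace X] (B : HyperbolicBox Γ U V o ε b ν m) {α : ℝ}
    (hα : 0 < α) :
    ∃ M : ℝ, 0 ≤ M ∧ ∀ (p q s : X) (F : Finset Γ), q ≠ s →
      (∀ k ∈ F, k⁻¹ • p ∈ U ∧ k⁻¹ • q ∈ V ∧ dist (k⁻¹ • s) (k⁻¹ • q) ≤ ε) →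
      ∑ k ∈ F, dist (k⁻¹ • s) (k⁻¹ • q) ^ α ≤ M := by
  classical
  obtain ⟨C, hC⟩ := B.exists_card_le
  have hr : Real.exp (-α) < 1 := by rw [Real.exp_lt_one_iff]; linarith
  have hsum : Summable fun n : ℕ => (C * (n + 2) : ℝ) * Real.exp (-α) ^ n := by
    have h1 := summable_pow_mul_geometric_of_norm_lt_one 1 (r := Real.exp (-α))
      (by rwa [Real.norm_eq_abs, abs_of_pos (Real.exp_pos _)])
    have h0 := summable_geometric_of_lt_one (Real.exp_pos (-α)).le hr
    refine ((h1.add (h0.mul_left 2)).mul_left (C : ℝ)).congr fun n => ?_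
    ring
  have hnn : ∀ n : ℕ, 0 ≤ (C * (n + 2) : ℝ) * Real.exp (-α) ^ n := fun n => by positivity
  refine ⟨∑' n : ℕ, (C * (n + 2) : ℝ) * Real.exp (-α) ^ n, tsum_nonneg hnn, fun p q s F hqs hF => ?_⟩
  set d : Γ → ℝ := fun k => dist (k⁻¹ • s) (k⁻¹ • q) with hd
  have dpos : ∀ k, 0 < d k := fun k => dist_pos.2 fun h => hqs ((smul_left_cancel _ h).symm)
  let ℓ : Γ → ℕ := fun k => ⌊-Real.log (d k)⌋₊
  have hdle : ∀ k ∈ F, d k ≤ Real.exp (-(ℓ k : ℝ)) := fun k hk => by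
    rw [← Real.log_le_iff_le_exp (dpos k)]
    have h1 : Real.log (d k) ≤ 0 :=
      Real.log_nonpos (dpos k).le ((hF k hk).2.2.trans B.ε_le_one)
    have := Nat.floor_le (a := -Real.log (d k)) (by linarith)
    simp only [ℓ]; linarith
  have hdge : ∀ k, Real.exp (-((ℓ k + 1 : ℕ) : ℝ)) ≤ d k := fun k => by
    rw [← Real.le_log_iff_exp_le (dpos k)]
    have := Nat.lt_floor_add_one (-Real.log (d k))
    push_cast
    simp only [ℓ]; linarith
  calc ∑ k ∈ F, d k ^ α = ∑ n ∈ F.image ℓ, ∑ k ∈ F with ℓ k = n, d k ^ α :=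
        (Finset.sum_fiberwise_of_maps_to (fun k hk => Finset.mem_image_of_mem ℓ hk) _).symm
    _ ≤ ∑ n ∈ F.image ℓ, (C * (n + 2) : ℝ) * Real.exp (-α) ^ n := by
        refine Finset.sum_le_sum fun n _ => ?_
        have hcard : (F.filter (fun k => ℓ k = n)).card ≤ C * (n + 1 + 1) := by
          refine hC p q s (n + 1) _ fun k hk => ?_
          rw [Finset.mem_filter] at hk
          obtain ⟨hk, rfl⟩ := hk
          obtain ⟨h1, h2, h3⟩ := hF k hk
          exact ⟨h1, h2, h3, hdge k⟩
        have hterm : ∀ k ∈ F.filter (fun k => ℓ k = n), d k ^ α ≤ Real.exp (-α) ^ n := by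
          intro k hk
          rw [Finset.mem_filter] at hk
          obtain ⟨hk, rfl⟩ := hk
          refine (Real.rpow_le_rpow (dpos k).le (hdle k hk) hα.le).trans (le_of_eq ?_)
          rw [← Real.exp_mul, ← Real.exp_nat_mul]
          congr 1; ring
        refine (Finset.sum_le_card_nsmul _ _ _ hterm).trans ?_
        rw [nsmul_eq_mul]
        have : ((F.filter (fun k => ℓ k = n)).card : ℝ) ≤ C * (n + 2) := by
          have : ((F.filter (fun k => ℓ k = n)).card : ℝ) ≤ (C * (n + 1 + 1) : ℕ) := by
            exact_mod_cast hcard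
          push_cast at this
          linarith
        gcongr
    _ ≤ _ := hsum.sum_le_tsum _ fun n _ => hnn n

/-- Returns of `(p, q)` that carry `o` away from `p` and `q` are finite in number. -/
theorem finite_returns [BoundedSpace X] [ContinuousConstSMul Γ X]
    (B : HyperbolicBox Γ U V o ε b ν m) {p q : X} {P Q : Set X} (hP : P ∈ 𝓝 p) (hQ : Q ∈ 𝓝 q) :
    {k : Γ | k⁻¹ • p ∈ U ∧ k⁻¹ • q ∈ V ∧ k • o ∉ P ∪ Q}.Finite := by
  obtain ⟨c, hc⟩ := B.encard_outside_le
  rcases {k : Γ | k⁻¹ • p ∈ U ∧ k⁻¹ • q ∈ V ∧ k • o ∉ P ∪ Q}.eq_empty_or_nonempty with h | h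
  · rw [h]; exact finite_empty
  obtain ⟨l, hl1, hl2, -⟩ := h
  have hnhds : ∀ (p : X) (P : Set X), P ∈ 𝓝 p → ∃ r > 0, ∀ z, z ∉ P → r ≤ dist (l⁻¹ • z) (l⁻¹ • p) := by
    intro p P hP
    have : (fun z => l • z) ⁻¹' P ∈ 𝓝 (l⁻¹ • p) :=
      (continuous_const_smul l).continuousAt.preimage_mem_nhds (by simpa using hP)
    obtain ⟨r, hr, hsub⟩ := Metric.mem_nhds_iff.1 this
    refine ⟨r, hr, fun z hz => ?_⟩
    by_contra! hlt
    exact hz (by simpa using hsub (Metric.mem_ball.2 hlt))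
  obtain ⟨r₁, hr₁, h₁⟩ := hnhds p P hP
  obtain ⟨r₂, hr₂, h₂⟩ := hnhds q Q hQ
  obtain ⟨n, hn⟩ := exists_nat_ge (-Real.log (min r₁ r₂))
  have hn' : Real.exp (-n) ≤ min r₁ r₂ := by
    rw [← Real.le_log_iff_exp_le (lt_min hr₁ hr₂)]; linarith
  have hfin := finite_of_encard_le_coe (hc n _ hl1 _ hl2)
  refine (hfin.preimage (f := fun k => l⁻¹ * k) (mul_right_injective _).injOn).subset ?_
  rintro k ⟨hk1, hk2, hk3⟩
  rw [mem_union, not_or] at hk3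
  refine ⟨by simpa [mul_smul], by simpa [mul_smul], ?_⟩
  rw [mul_smul]
  exact hn'.trans (min_le_min (h₁ _ hk3.1) (h₂ _ hk3.2))

/-- For a triple `(p, q, s)`, only boundedly many returns `k` of `(p, q)` put `k⁻¹ s` at
distance more than `ν` from `U ∪ V`. -/
theorem card_far_le (B : HyperbolicBox Γ U V o ε b ν m) (p q s : X) (F : Finset Γ)
    (hF : ∀ k ∈ F, k⁻¹ • p ∈ U ∧ k⁻¹ • q ∈ V ∧ ν < Metric.infDist (k⁻¹ • s) (U ∪ V)) :
    F.card ≤ m := by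
  classical
  rcases F.eq_empty_or_nonempty with rfl | ⟨l, hl⟩
  · simp
  obtain ⟨l1, l2, l3⟩ := hF l hl
  have h3 : ((F.image (fun k => l⁻¹ * k) : Finset Γ) : Set Γ).encard ≤ m := by
    refine le_trans (encard_le_encard ?_) B.far
    intro g hg
    simp only [Finset.coe_image, mem_image, Finset.mem_coe] at hg
    obtain ⟨k, hk, rfl⟩ := hg
    obtain ⟨h1, h2, h3⟩ := hF k hk
    exact ⟨_, h1, _, h2, k⁻¹ • s, h3, by simpa [mul_smul], by simpa [mul_smul], by simpa [mul_smul]⟩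
  rw [encard_coe_eq_coe_finsetCard, Finset.card_image_of_injective _ (mul_right_injective _)] at h3
  exact_mod_cast h3

end HyperbolicBox

end Box

/-! ### The cocycle of a Hölder kernel -/

section Kernel

variable {Γ X E : Type*} [Group Γ] [MulAction Γ X] [NormedAddCommGroup E]

/-- The contribution of `k (C ∪ ι C)` to the integral over the whole leaf through `p` and `q`. -/
def legTerm (H : X → X → E) (k : Γ) (p q : X) : E :=
  H (k⁻¹ • p) (k⁻¹ • q) - H (k⁻¹ • q) (k⁻¹ • p)

variable {H : X → X → E}

theorem legTerm_swap (k : Γ) (p q : X) : legTerm H k q p = -legTerm H k p q := by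
  simp [legTerm]

@[simp] theorem legTerm_self (k : Γ) (p : X) : legTerm H k p p = 0 := by
  simp [legTerm]

theorem legTerm_smul (g k : Γ) (p q : X) :
    legTerm H k (g • p) (g • q) = legTerm H (g⁻¹ * k) p q := by
  simp [legTerm, mul_smul]

/-- The contribution of `k (C ∪ ι C)` to the sum of the integrals over the three leaves spanned by
`p`, `q` and `s`. -/
def triTerm (H : X → X → E) (k : Γ) (p q s : X) : E :=
  legTerm H k p q + legTerm H k q s + legTerm H k s p

theorem triTerm_rotate (k : Γ) (p q s : X) : triTerm H k q s p = triTerm H k p q s := by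
  simp only [triTerm]; abel

theorem triTerm_swap (k : Γ) (p q s : X) : triTerm H k q p s = -triTerm H k p q s := by
  simp only [triTerm, legTerm]; abel

variable [MetricSpace X]

/-- A bounded function `H : X → X → E` supported in `U × V` which is Hölder continuous at distances
at most `1` in each variable. For the leaf integrals, `H u v` is the function
`w ↦ ψ (u, v) f (u, v, w)`. -/
structure HolderKernel (U V : Set X) (H : X → X → E) : Prop where
  supp : ∀ u v, ¬ (u ∈ U ∧ v ∈ V) → H u v = 0
  bdd : ∃ K : ℝ, ∀ u v, ‖H u v‖ ≤ K
  holder : ∃ L α : ℝ, 0 < α ∧ (∀ u v t, dist v t ≤ 1 → ‖H u v - H u t‖ ≤ L * dist v t ^ α) ∧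
    ∀ u v t, dist v t ≤ 1 → ‖H v u - H t u‖ ≤ L * dist v t ^ α

theorem HolderKernel.symm {U V : Set X} {H : X → X → E} (h : HolderKernel U V H) :
    HolderKernel V U (fun u v => H v u) where
  supp u v huv := h.supp v u fun ⟨h1, h2⟩ => huv ⟨h2, h1⟩
  bdd := by
    obtain ⟨K, hK⟩ := h.bdd
    exact ⟨K, fun u v => hK v u⟩
  holder := by
    obtain ⟨L, α, hα, h1, h2⟩ := h.holder
    exact ⟨L, α, hα, h2, h1⟩

variable {U V : Set X} {o : X} {ε b ν : ℝ} {m : ℕ}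

theorem HolderKernel.exists_norm_triTerm_le (hH : HolderKernel U V H) :
    ∃ K : ℝ, 0 ≤ K ∧ ∀ (k : Γ) (p q s : X), ‖triTerm H k p q s‖ ≤ K := by
  obtain ⟨K, hK⟩ := hH.bdd
  have hleg : ∀ (k : Γ) (p q : X), ‖legTerm H k p q‖ ≤ K + K := fun k p q =>
    (norm_sub_le _ _).trans (add_le_add (hK _ _) (hK _ _))
  refine ⟨max 0 (K + K + (K + K) + (K + K)), le_max_left _ _, fun k p q s =>
    le_trans ?_ (le_max_right _ _)⟩
  exact (norm_add₃_le).trans (add_le_add_three (hleg _ _ _) (hleg _ _ _) (hleg _ _ _))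

namespace HyperbolicBox

/-- If `k⁻¹ s` lies close to `k⁻¹ q ∈ V`, then the leaf through `q` and `s` misses
`k (C ∪ ι C)`, and the contributions of the other two leaves differ only by moving the endpoint from
`k⁻¹ q` to `k⁻¹ s`. -/
theorem triTerm_eq_of_close (B : HyperbolicBox Γ U V o ε b ν m) (hH : HolderKernel U V H)
    {k : Γ} {p q s : X} (hu : k⁻¹ • p ∈ U) (hv : k⁻¹ • q ∈ V)
    (ht : dist (k⁻¹ • s) (k⁻¹ • q) ≤ ε) :
    triTerm H k p q s = H (k⁻¹ • p) (k⁻¹ • q) - H (k⁻¹ • p) (k⁻¹ • s) := by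
  have hε := B.ε_pos
  have hnU : ∀ v ∈ V, v ∉ U := fun v hv hu => by
    have := B.sep_UV v hu v hv
    rw [dist_self] at this; linarith
  have htU : k⁻¹ • s ∉ U := fun h => by
    have := B.sep_UV _ h _ hv; linarith
  have hpV : k⁻¹ • p ∉ V := fun h => hnU _ h hu
  simp only [triTerm, legTerm]
  rw [hH.supp (k⁻¹ • q) (k⁻¹ • p) fun h => hpV h.2, hH.supp (k⁻¹ • q) (k⁻¹ • s) fun h => hnU _ hv h.1,
    hH.supp (k⁻¹ • s) (k⁻¹ • q) fun h => htU h.1, hH.supp (k⁻¹ • s) (k⁻¹ • p) fun h => hpV h.2]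
  abel

theorem exists_sum_triTerm_le_of_close [BoundedSpace X] (B : HyperbolicBox Γ U V o ε b ν m)
    (hH : HolderKernel U V H) :
    ∃ M : ℝ, 0 ≤ M ∧ ∀ (p q s : X) (F : Finset Γ), q ≠ s →
      (∀ k ∈ F, k⁻¹ • p ∈ U ∧ k⁻¹ • q ∈ V ∧ dist (k⁻¹ • s) (k⁻¹ • q) ≤ ε) →
      ∑ k ∈ F, ‖triTerm H k p q s‖ ≤ M := by
  obtain ⟨L, α, hα, hL, -⟩ := hH.holder
  obtain ⟨M, hM0, hM⟩ := B.exists_sum_rpow_le hα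
  refine ⟨|L| * M, by positivity, fun p q s F hqs hF => ?_⟩
  refine le_trans ?_ (mul_le_mul_of_nonneg_left (hM p q s F hqs hF) (abs_nonneg L))
  rw [Finset.mul_sum]
  refine Finset.sum_le_sum fun k hk => ?_
  obtain ⟨h1, h2, h3⟩ := hF k hk
  rw [B.triTerm_eq_of_close hH h1 h2 h3]
  rw [dist_comm] at h3
  refine (hL _ _ _ (h3.trans B.ε_le_one)).trans ?_
  rw [dist_comm]
  gcongr
  exact le_abs_self L

theorem exists_sum_triTerm_le_of_mem [BoundedSpace X] (B : HyperbolicBox Γ U V o ε b ν m)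
    (hH : HolderKernel U V H) :
    ∃ M : ℝ, 0 ≤ M ∧ ∀ (p q s : X) (F : Finset Γ), p ≠ s → q ≠ s →
      (∀ k ∈ F, k⁻¹ • p ∈ U ∧ k⁻¹ • q ∈ V) → ∑ k ∈ F, ‖triTerm H k p q s‖ ≤ M := by
  classical
  obtain ⟨M₁, h₁, hM₁⟩ := B.exists_sum_triTerm_le_of_close hH
  obtain ⟨M₂, h₂, hM₂⟩ := B.symm.exists_sum_triTerm_le_of_close hH.symm
  obtain ⟨K, h₀, hK⟩ := hH.exists_norm_triTerm_le (Γ := Γ)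
  refine ⟨m * K + (M₁ + M₂), by positivity, fun p q s F hps hqs hF => ?_⟩
  let far : Γ → Prop := fun k => ν < Metric.infDist (k⁻¹ • s) (U ∪ V)
  let close : Γ → Prop := fun k => dist (k⁻¹ • s) (k⁻¹ • q) ≤ ε
  have hclose : ∀ k ∈ F, ¬ far k → ¬ close k → dist (k⁻¹ • s) (k⁻¹ • p) ≤ ε := by
    intro k hk hfar hcl
    obtain ⟨hu, hv⟩ := hF k hk
    have hν := B.ν_pos
    have hlt : Metric.infDist (k⁻¹ • s) (U ∪ V) < 2 * ν := by
      simp only [far, not_lt] at hfar; linarith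
    obtain ⟨y, hy, hyd⟩ := (Metric.infDist_lt_iff (show (U ∪ V).Nonempty from ⟨_, Or.inl hu⟩)).1 hlt
    have hνε := B.ν_le
    rcases hy with hy | hy
    · have := dist_triangle (k⁻¹ • s) y (k⁻¹ • p)
      linarith [B.small_U y hy _ hu]
    · exfalso
      have := dist_triangle (k⁻¹ • s) y (k⁻¹ • q)
      exact hcl (by linarith [B.small_V y hy _ hv])
  rw [← Finset.sum_filter_add_sum_filter_not F far,
    ← Finset.sum_filter_add_sum_filter_not (F.filter fun k => ¬ far k) close]
  gcongr
  · have hcard := B.card_far_le p q s (F.filter far) fun k hk => by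
      rw [Finset.mem_filter] at hk
      exact ⟨(hF k hk.1).1, (hF k hk.1).2, hk.2⟩
    refine (Finset.sum_le_card_nsmul _ _ K fun k _ => hK k p q s).trans ?_
    rw [nsmul_eq_mul]
    gcongr
  · refine hM₁ p q s _ hqs fun k hk => ?_
    simp only [Finset.mem_filter] at hk
    exact ⟨(hF k hk.1.1).1, (hF k hk.1.1).2, hk.2⟩
  · have e : ∀ k : Γ, ‖triTerm H k p q s‖ = ‖triTerm (fun u v => H v u) k q p s‖ := fun k => by
      congr 1
      simp only [triTerm, legTerm]
      abel
    simp only [e]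
    refine hM₂ q p s _ hps fun k hk => ?_
    simp only [Finset.mem_filter] at hk
    exact ⟨(hF k hk.1.1).2, (hF k hk.1.1).1, hclose k hk.1.1 hk.1.2 hk.2⟩

/-- The integrals over the sides of a triangle cancel, up to an absolutely convergent sum with a
bound that does not depend on the triangle. -/
theorem exists_sum_triTerm_le [BoundedSpace X] (B : HyperbolicBox Γ U V o ε b ν m)
    (hH : HolderKernel U V H) :
    ∃ M : ℝ, 0 ≤ M ∧ ∀ (p q s : X) (F : Finset Γ), ∑ k ∈ F, ‖triTerm H k p q s‖ ≤ M := by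
  classical
  obtain ⟨M, h0, hM⟩ := B.exists_sum_triTerm_le_of_mem hH
  refine ⟨6 * M, by positivity, fun p q s F => ?_⟩
  by_cases hdeg : p = q ∨ q = s ∨ s = p
  · have : ∀ k : Γ, triTerm H k p q s = 0 := by
      intro k
      rcases hdeg with rfl | rfl | rfl <;> simp [triTerm, legTerm]
    simp only [this, norm_zero, Finset.sum_const_zero]
    positivity
  push Not at hdeg
  obtain ⟨hpq, hqs, hsp⟩ := hdeg
  let T : X → X → Finset Γ := fun p q => F.filter fun k => k⁻¹ • p ∈ U ∧ k⁻¹ • q ∈ V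
  have hT : ∀ p q, ∀ k ∈ T p q, k⁻¹ • p ∈ U ∧ k⁻¹ • q ∈ V := fun p q k hk =>
    (Finset.mem_filter.1 hk).2
  have hcover : ∀ k ∈ F, ‖triTerm H k p q s‖ ≤
      (if k ∈ T p q then ‖triTerm H k p q s‖ else 0) +
      (if k ∈ T q p then ‖triTerm H k p q s‖ else 0) +
      (if k ∈ T q s then ‖triTerm H k p q s‖ else 0) +
      (if k ∈ T s q then ‖triTerm H k p q s‖ else 0) +
      (if k ∈ T s p then ‖triTerm H k p q s‖ else 0) +
      (if k ∈ T p s then ‖triTerm H k p q s‖ else 0) := by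
    intro k hk
    have hnn := norm_nonneg (triTerm H k p q s)
    have hz : ∀ p q, k ∉ T p q → H (k⁻¹ • p) (k⁻¹ • q) = 0 := fun p q h =>
      hH.supp _ _ fun h' => h (Finset.mem_filter.2 ⟨hk, h'⟩)
    by_cases h1 : k ∈ T p q
    · rw [if_pos h1]
      have : ∀ (P : Prop) [Decidable P], 0 ≤ if P then ‖triTerm H k p q s‖ else 0 := fun P _ => by
        split_ifs <;> simp
      linarith [this (k ∈ T q p), this (k ∈ T q s), this (k ∈ T s q), this (k ∈ T s p),
        this (k ∈ T p s)]
    by_cases h2 : k ∈ T q p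
    · split_ifs <;> linarith
    by_cases h3 : k ∈ T q s
    · split_ifs <;> linarith
    by_cases h4 : k ∈ T s q
    · split_ifs <;> linarith
    by_cases h5 : k ∈ T s p
    · split_ifs <;> linarith
    by_cases h6 : k ∈ T p s
    · split_ifs
      linarith
    have : triTerm H k p q s = 0 := by
      simp only [triTerm, legTerm]
      rw [hz _ _ h1, hz _ _ h2, hz _ _ h3, hz _ _ h4, hz _ _ h5, hz _ _ h6]
      simp
    simp [this]
  have hsum : ∀ (p' q' s' : X), p' ≠ s' → q' ≠ s' →
      (∀ k : Γ, ‖triTerm H k p q s‖ = ‖triTerm H k p' q' s'‖) →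
      ∑ k ∈ F, (if k ∈ T p' q' then ‖triTerm H k p q s‖ else 0) ≤ M := by
    intro p' q' s' h1 h2 he
    rw [← Finset.sum_filter]
    simp only [he]
    refine hM p' q' s' _ h1 h2 fun k hk => hT p' q' k (Finset.mem_filter.1 hk).2
  refine (Finset.sum_le_sum hcover).trans ?_
  simp only [Finset.sum_add_distrib]
  have e1 := hsum p q s hsp.symm hqs fun k => rfl
  have e2 := hsum q p s hqs hsp.symm fun k => by rw [triTerm_swap, norm_neg]
  have e3 := hsum q s p hpq.symm hsp fun k => by rw [triTerm_rotate k p q s]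
  have e4 := hsum s q p hsp hpq.symm fun k => by
    rw [triTerm_swap k q s p, norm_neg, triTerm_rotate k p q s]
  have e5 := hsum s p q hqs.symm hpq fun k => by rw [← triTerm_rotate k s p q]
  have e6 := hsum p s q hpq hqs.symm fun k => by
    rw [triTerm_swap k s p q, norm_neg, ← triTerm_rotate k s p q]
  linarith

theorem summable_triTerm [BoundedSpace X] (B : HyperbolicBox Γ U V o ε b ν m)
    (hH : HolderKernel U V H) (p q s : X) : Summable fun k : Γ => ‖triTerm H k p q s‖ := by
  obtain ⟨M, -, hM⟩ := B.exists_sum_triTerm_le hH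
  exact summable_of_sum_le (fun k => norm_nonneg _) (hM p q s)

/-- Away from `p` and `q`, the leaf through these points meets only finitely many translates of
the box. -/
theorem finite_legTerm [BoundedSpace X] [ContinuousConstSMul Γ X]
    (B : HyperbolicBox Γ U V o ε b ν m) (hH : HolderKernel U V H) {p q : X} {P Q : Set X}
    (hP : P ∈ 𝓝 p) (hQ : Q ∈ 𝓝 q) :
    {k : Γ | legTerm H k p q ≠ 0 ∧ k • o ∉ P ∪ Q}.Finite := by
  refine ((B.finite_returns hP hQ).union (B.finite_returns hQ hP)).subset ?_
  rintro k ⟨hk, hk'⟩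
  by_contra hcon
  simp only [mem_union, mem_ofPred_eq, not_or, not_and, not_not] at hcon hk'
  apply hk
  rw [legTerm, hH.supp _ _ fun h => ?_, hH.supp _ _ fun h => ?_, sub_zero]
  · have := hcon.2 h.1 h.2; tauto
  · have := hcon.1 h.1 h.2; tauto

theorem summable_indicator_legTerm [BoundedSpace X] [ContinuousConstSMul Γ X]
    (B : HyperbolicBox Γ U V o ε b ν m) (hH : HolderKernel U V H) {p q : X} {P Q N : Set X}
    (hP : P ∈ 𝓝 p) (hQ : Q ∈ 𝓝 q) (hN : Disjoint N (P ∪ Q)) :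
    Summable ({k : Γ | k • o ∈ N}.indicator fun k => ‖legTerm H k p q‖) := by
  refine summable_of_hasFiniteSupport ((B.finite_legTerm hH hP hQ).subset fun k hk => ?_)
  rw [Function.mem_support, indicator_apply_ne_zero] at hk
  exact ⟨norm_ne_zero_iff.1 hk.2, disjoint_left.1 hN hk.1⟩

end HyperbolicBox

end Kernel

/-! ### Summation over the leaves through two points of an orbit -/

section OrbitSum

variable {Γ X E : Type*} [Group Γ] [MetricSpace X] [MulAction Γ X] [NormedAddCommGroup E]
  {H : X → X → E} {U V : Set X} {o : X} {ε b ν : ℝ} {m : ℕ}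

theorem exists_nhds_disjoint_union {x y q : X} (hxy : x ≠ y) (hxq : x ≠ q) :
    ∃ P ∈ 𝓝 x, ∃ Y ∈ 𝓝 y, ∃ Q ∈ 𝓝 q, Disjoint P (Y ∪ Q) := by
  obtain ⟨P₁, Y, h1, hY, d1⟩ := t2_separation_nhds hxy
  obtain ⟨P₂, Q, h2, hQ, d2⟩ := t2_separation_nhds hxq
  exact ⟨P₁ ∩ P₂, inter_mem h1 h2, Y, hY, Q, hQ, disjoint_union_right.2
    ⟨d1.mono_left inter_subset_left, d2.mono_left inter_subset_right⟩⟩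

namespace HyperbolicBox

/-- Suppose that the leaf through `x` and `y` misses all translates of the box. Then the leaf from
`x` to any other point `q` contributes an absolutely convergent sum near `x`: near `x` it is
compared with the leaf from `x` to `y` through the triangle `x, q, y`. -/
theorem exists_summable_near [BoundedSpace X] [ContinuousConstSMul Γ X]
    (B : HyperbolicBox Γ U V o ε b ν m) (hH : HolderKernel U V H) {x y : X} (hxy : x ≠ y)
    (h0 : ∀ k : Γ, legTerm H k x y = 0) {q : X} (hq : q ≠ x) :
    ∃ P ∈ 𝓝 x, Summable ({k : Γ | k • o ∈ P}.indicator fun k => ‖legTerm H k x q‖) := by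
  obtain ⟨P, hP, Y, hY, Q, hQ, hd⟩ := exists_nhds_disjoint_union hxy hq.symm
  refine ⟨P, hP, ?_⟩
  have h1 := B.summable_indicator_legTerm hH hQ hY (by rwa [union_comm])
  refine Summable.of_nonneg_of_le (fun k => indicator_nonneg (fun _ _ => norm_nonneg _) _)
    (fun k => ?_) ((B.summable_triTerm hH x q y).add h1)
  by_cases hk : k ∈ {k : Γ | k • o ∈ P}
  · rw [indicator_of_mem hk, indicator_of_mem hk]
    have : legTerm H k x q = triTerm H k x q y - legTerm H k q y := by
      rw [triTerm, legTerm_swap k x y, h0 k]; abel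
    rw [this]
    exact norm_sub_le _ _
  · rw [indicator_of_notMem hk, indicator_of_notMem hk, add_zero]
    exact norm_nonneg _

/-- If the leaf through `x` and some other point misses all translates of the box, then the sum of
the contributions to the leaf through `x` and `g x` converges absolutely. The part near `g x`
is the translate by `g` of the part near `x` of the leaf through `g⁻¹ x` and `x`. -/
theorem summable_legTerm_orbit [BoundedSpace X] [ContinuousConstSMul Γ X]
    (B : HyperbolicBox Γ U V o ε b ν m) (hH : HolderKernel U V H) {x y : X} (hxy : x ≠ y)
    (h0 : ∀ k : Γ, legTerm H k x y = 0) (g : Γ) :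
    Summable fun k : Γ => ‖legTerm H k x (g • x)‖ := by
  by_cases hg : g • x = x
  · simp [hg, summable_zero]
  have hg' : g⁻¹ • x ≠ x := fun h => hg (by rw [inv_smul_eq_iff] at h; exact h.symm)
  obtain ⟨P, hP, hsP⟩ := B.exists_summable_near hH hxy h0 hg
  obtain ⟨Q, hQ, hsQ⟩ := B.exists_summable_near hH hxy h0 hg'
  have hQ' : (fun z => g⁻¹ • z) ⁻¹' Q ∈ 𝓝 (g • x) :=
    (continuous_const_smul g⁻¹).continuousAt.preimage_mem_nhds (by simpa using hQ)
  have hfin : Summable ({k : Γ | legTerm H k x (g • x) ≠ 0 ∧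
      k • o ∉ P ∪ (fun z => g⁻¹ • z) ⁻¹' Q}.indicator fun k => ‖legTerm H k x (g • x)‖) :=
    summable_of_hasFiniteSupport ((B.finite_legTerm hH hP hQ').subset support_indicator_subset)
  have hsQ' := (Equiv.mulLeft g⁻¹).summable_iff.2 hsQ
  refine Summable.of_nonneg_of_le (fun k => norm_nonneg _) (fun k => ?_) ((hsP.add hsQ').add hfin)
  have n1 : 0 ≤ {k : Γ | k • o ∈ P}.indicator (fun k => ‖legTerm H k x (g • x)‖) k :=
    indicator_nonneg (fun _ _ => norm_nonneg _) _
  have n2 : 0 ≤ ({k : Γ | k • o ∈ Q}.indicator (fun k => ‖legTerm H k x (g⁻¹ • x)‖) ∘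
      (Equiv.mulLeft g⁻¹)) k := indicator_nonneg (fun _ _ => norm_nonneg _) _
  have n3 : 0 ≤ {k : Γ | legTerm H k x (g • x) ≠ 0 ∧
      k • o ∉ P ∪ (fun z => g⁻¹ • z) ⁻¹' Q}.indicator (fun k => ‖legTerm H k x (g • x)‖) k :=
    indicator_nonneg (fun _ _ => norm_nonneg _) _
  by_cases h1 : k • o ∈ P
  · rw [indicator_of_mem (by exact h1)] at n1 ⊢
    linarith
  by_cases h2 : g⁻¹ • k • o ∈ Q
  · have e : ({k : Γ | k • o ∈ Q}.indicator (fun k => ‖legTerm H k x (g⁻¹ • x)‖) ∘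
      (Equiv.mulLeft g⁻¹)) k = ‖legTerm H k x (g • x)‖ := by
      simp only [Function.comp, Equiv.coe_mulLeft]
      rw [indicator_of_mem (by rwa [mem_ofPred_eq, mul_smul]), ← legTerm_smul, smul_inv_smul,
        legTerm_swap, norm_neg]
    rw [e]
    linarith
  by_cases h3 : legTerm H k x (g • x) = 0
  · rw [h3, norm_zero]
    linarith
  · rw [indicator_of_mem (show k ∈ {k : Γ | legTerm H k x (g • x) ≠ 0 ∧
      k • o ∉ P ∪ (fun z => g⁻¹ • z) ⁻¹' Q} from ⟨h3, by simp [h1, h2]⟩)]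
    linarith

/-- The function `g ↦ ∑ₖ legTerm H k x (g x)` is a quasimorphism with values in `E`. -/
theorem exists_norm_tsum_legTerm_le [BoundedSpace X] (B : HyperbolicBox Γ U V o ε b ν m)
    (hH : HolderKernel U V H) {x : X} [CompleteSpace E]
    (hS : ∀ g : Γ, Summable fun k : Γ => ‖legTerm H k x (g • x)‖) :
    ∃ M : ℝ, ∀ g h : Γ, ‖∑' k : Γ, legTerm H k x (g • x) + ∑' k : Γ, legTerm H k x (h • x) -
      ∑' k : Γ, legTerm H k x ((g * h) • x)‖ ≤ M := by
  obtain ⟨M, -, hM⟩ := B.exists_sum_triTerm_le hH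
  refine ⟨M, fun g h => ?_⟩
  have hshift : ∀ k : Γ, legTerm H (g⁻¹ * k) x (h • x) = legTerm H k (g • x) ((g * h) • x) :=
    fun k => by rw [← legTerm_smul, mul_smul]
  have e1 : ∑' k : Γ, legTerm H k x (h • x) = ∑' k : Γ, legTerm H k (g • x) ((g * h) • x) := by
    rw [← (Equiv.mulLeft g⁻¹).tsum_eq]
    exact tsum_congr hshift
  have s1 := (hS g).of_norm
  have s2 : Summable fun k : Γ => legTerm H k (g • x) ((g * h) • x) :=
    ((Equiv.mulLeft g⁻¹).summable_iff.2 (hS h).of_norm).congr hshift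
  have s3 := (hS (g * h)).of_norm
  rw [e1, ← s1.tsum_add s2, ← (s1.add s2).tsum_sub s3]
  have e2 : ∀ k : Γ, legTerm H k x (g • x) + legTerm H k (g • x) ((g * h) • x) -
      legTerm H k x ((g * h) • x) = triTerm H k x (g • x) ((g * h) • x) := fun k => by
    rw [triTerm, legTerm_swap k x ((g * h) • x)]; abel
  simp only [e2]
  have := B.summable_triTerm hH x (g • x) ((g * h) • x)
  exact (norm_tsum_le_tsum_norm this).trans (this.tsum_le_of_sum_le (hM _ _ _))

/-- On the part of the leaf from `x` to `a` near `a`, this leaf is asymptotic to the leaf from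
`b` to `a`; the rest of it contributes an absolutely convergent sum. -/
theorem summable_legTerm_add_indicator [BoundedSpace X] [ContinuousConstSMul Γ X]
    (B : HyperbolicBox Γ U V o ε b ν m) (hH : HolderKernel U V H) {x y : X} (hxy : x ≠ y)
    (h0 : ∀ k : Γ, legTerm H k x y = 0) {a b' : X} (hax : a ≠ x) {P Q N : Set X}
    (hP : P ∈ 𝓝 x) (hQ : Q ∈ 𝓝 b') (hN : N ∈ 𝓝 a) (hd : Disjoint N (P ∪ Q)) :
    Summable fun k : Γ =>
      ‖legTerm H k x a + {k : Γ | k • o ∈ N}.indicator (fun k => legTerm H k a b') k‖ := by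
  obtain ⟨P', hP', hsP⟩ := B.exists_summable_near hH hxy h0 hax
  have hfin : Summable ({k : Γ | legTerm H k x a ≠ 0 ∧ k • o ∉ P' ∪ N}.indicator
      fun k => ‖legTerm H k x a‖) :=
    summable_of_hasFiniteSupport ((B.finite_legTerm hH hP' hN).subset support_indicator_subset)
  have hb := B.summable_indicator_legTerm hH hP hQ hd
  refine Summable.of_nonneg_of_le (fun k => norm_nonneg _) (fun k => ?_)
    (((B.summable_triTerm hH x a b').add hb).add (hsP.add hfin))
  have n1 : 0 ≤ ‖triTerm H k x a b'‖ := norm_nonneg _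
  have n2 : 0 ≤ {k : Γ | k • o ∈ N}.indicator (fun k => ‖legTerm H k x b'‖) k :=
    indicator_nonneg (fun _ _ => norm_nonneg _) _
  have n3 : 0 ≤ {k : Γ | k • o ∈ P'}.indicator (fun k => ‖legTerm H k x a‖) k :=
    indicator_nonneg (fun _ _ => norm_nonneg _) _
  have n4 : 0 ≤ {k : Γ | legTerm H k x a ≠ 0 ∧ k • o ∉ P' ∪ N}.indicator
      (fun k => ‖legTerm H k x a‖) k := indicator_nonneg (fun _ _ => norm_nonneg _) _
  by_cases hk : k • o ∈ N
  · rw [indicator_of_mem (s := {k : Γ | k • o ∈ N}) hk] at n2 ⊢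
    rw [indicator_of_mem (s := {k : Γ | k • o ∈ N}) hk]
    have : legTerm H k x a + legTerm H k a b' = triTerm H k x a b' + legTerm H k x b' := by
      rw [triTerm, legTerm_swap k x b']; abel
    rw [this]
    have := norm_add_le (triTerm H k x a b') (legTerm H k x b')
    linarith
  · rw [indicator_of_notMem (s := {k : Γ | k • o ∈ N}) hk, add_zero]
    by_cases h1 : k • o ∈ P'
    · rw [indicator_of_mem (s := {k : Γ | k • o ∈ P'}) h1] at n3 ⊢
      linarith
    by_cases h3 : legTerm H k x a = 0
    · rw [h3, norm_zero]
      linarith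
    · have hmem : k ∈ {k : Γ | legTerm H k x a ≠ 0 ∧ k • o ∉ P' ∪ N} := ⟨h3, by simp [h1, hk]⟩
      rw [indicator_of_mem hmem] at n4 ⊢
      linarith

/-- Let `h` fix `a` and `b'`. Up to a bounded error, the sum over the leaf from `x` to `h x` is minus
the sum over the part of the leaf from `a` to `b'` between a neighbourhood `N` of `a` and its image
`h N`. -/
theorem exists_norm_tsum_add_le [BoundedSpace X] [ContinuousConstSMul Γ X] [CompleteSpace E]
    (B : HyperbolicBox Γ U V o ε b ν m) (hH : HolderKernel U V H) {x y : X} (hxy : x ≠ y)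
    (h0 : ∀ k : Γ, legTerm H k x y = 0) {a b' : X} (hax : a ≠ x) {P Q N : Set X}
    (hP : P ∈ 𝓝 x) (hQ : Q ∈ 𝓝 b') (hN : N ∈ 𝓝 a) (hd : Disjoint N (P ∪ Q)) :
    ∃ M : ℝ, ∀ h : Γ, h • a = a → h • b' = b' →
      (Summable fun k : Γ => {k : Γ | k • o ∈ N}.indicator (fun k => legTerm H k a b') k -
        {k : Γ | (h⁻¹ * k) • o ∈ N}.indicator (fun k => legTerm H k a b') k) ∧
      ‖∑' k : Γ, legTerm H k x (h • x) +
        ∑' k : Γ, ({k : Γ | k • o ∈ N}.indicator (fun k => legTerm H k a b') k -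
        {k : Γ | (h⁻¹ * k) • o ∈ N}.indicator (fun k => legTerm H k a b') k)‖ ≤ M := by
  obtain ⟨M, -, hM⟩ := B.exists_sum_triTerm_le hH
  refine ⟨M, fun h ha hb => ?_⟩
  have sρ := (B.summable_legTerm_add_indicator hH hxy h0 hax hP hQ hN hd).of_norm
  obtain ⟨I, hI⟩ : ∃ I : Γ → E, I = {k : Γ | k • o ∈ N}.indicator (fun k => legTerm H k a b') :=
    ⟨_, rfl⟩
  rw [← hI] at sρ ⊢
  obtain ⟨ρ, hρ⟩ : ∃ ρ : Γ → E, ρ = fun k => legTerm H k x a + I k := ⟨_, rfl⟩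
  rw [← hρ] at sρ
  have sρ' : Summable fun k => ρ (h⁻¹ * k) := (Equiv.mulLeft h⁻¹).summable_iff.2 sρ
  have tρ' : ∑' k, ρ (h⁻¹ * k) = ∑' k, ρ k := (Equiv.mulLeft h⁻¹).tsum_eq ρ
  have sx := (B.summable_legTerm_orbit hH hxy h0 h).of_norm
  have sT := B.summable_triTerm hH x (h • x) a
  have eI : ∀ k : Γ, {k : Γ | (h⁻¹ * k) • o ∈ N}.indicator (fun k => legTerm H k a b') k =
      I (h⁻¹ * k) := fun k => by
    have : legTerm H (h⁻¹ * k) a b' = legTerm H k a b' := by rw [← legTerm_smul, ha, hb]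
    simp only [hI, indicator, mem_ofPred_eq, this]
  -- The remainder `ρ` is summable and does not depend on `h`, so its shift by `h` cancels.
  simp only [eI]
  have key : ∀ k : Γ, I k - I (h⁻¹ * k) =
      triTerm H k x (h • x) a + (ρ k - ρ (h⁻¹ * k)) - legTerm H k x (h • x) := fun k => by
    have : legTerm H (h⁻¹ * k) x a = legTerm H k (h • x) a := by rw [← legTerm_smul, ha]
    simp only [hρ, triTerm, this, legTerm_swap k x a]
    abel
  simp only [key]
  have s1 := sT.of_norm.add (sρ.sub sρ')
  refine ⟨s1.sub sx, ?_⟩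
  rw [s1.tsum_sub sx, sT.of_norm.tsum_add (sρ.sub sρ'), sρ.tsum_sub sρ', tρ', sub_self, add_zero,
    add_sub_cancel]
  exact (norm_tsum_le_tsum_norm sT).trans (sT.tsum_le_of_sum_le (hM _ _ _))

end HyperbolicBox

end OrbitSum

/-! ### Orbits of pairs and of small boxes -/

section Orbits

variable {Γ X : Type*} [Group Γ] [MulAction Γ X]

@[simp] theorem tripleFlip_tripleFlip (p : X × X × X) : tripleFlip (tripleFlip p) = p := rfl

theorem smul_tripleFlip (g : Γ) (p : X × X × X) : g • tripleFlip p = tripleFlip (g • p) := rfl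

variable [MetricSpace X]

theorem NorthSouth.symm {g : Γ} {a b : X} (h : NorthSouth g a b) : NorthSouth g⁻¹ b a := by
  obtain ⟨hab, ha, hb, hdyn, δ, hδ, hU⟩ := h
  refine ⟨hab.symm, inv_smul_eq_iff.2 hb.symm, inv_smul_eq_iff.2 ha.symm, fun ε hε => ?_,
    δ, hδ, ?_⟩
  · obtain ⟨m, hm, h1, h2⟩ := hdyn ε hε
    exact ⟨m, hm, by simpa [inv_pow] using h2, by simpa [inv_pow] using h1⟩
  · rw [pair_comm b a, ← hU, union_comm]
    refine (Equiv.neg ℤ).iSup_congr fun m => ?_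
    simp

theorem exists_ne_ne (hX : ∀ x : X, (𝓝[≠] x).NeBot) (a b : X) : ∃ z : X, z ≠ a ∧ z ≠ b := by
  by_cases hab : a = b
  · obtain ⟨z, hz⟩ := (hX a).nonempty_of_mem self_mem_nhdsWithin
    exact ⟨z, hz, hab ▸ hz⟩
  · have : {b}ᶜ ∩ {a}ᶜ ∈ 𝓝[≠] a :=
      inter_mem (mem_nhdsWithin_of_mem_nhds (isOpen_compl_singleton.mem_nhds hab))
        self_mem_nhdsWithin
    obtain ⟨z, hz1, hz2⟩ := (hX a).nonempty_of_mem this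
    exact ⟨z, hz2, hz1⟩

theorem lt_infDist_union_ball {a b z : X} {ν r : ℝ} (hν : 0 < ν) (hr : 0 < r) (hrν : r ≤ ν)
    (ha : 4 * ν ≤ dist z a) (hb : 4 * ν ≤ dist z b) :
    ν < Metric.infDist z (Metric.ball a r ∪ Metric.ball b r) := by
  refine lt_of_lt_of_le (by linarith : ν < 3 * ν) ((Metric.le_infDist ⟨a, Or.inl
    (Metric.mem_ball_self hr)⟩).2 ?_)
  rintro y (hy | hy)
  · have := dist_triangle z y a
    rw [Metric.mem_ball] at hy; linarith
  · have := dist_triangle z y b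
    rw [Metric.mem_ball] at hy; linarith

theorem le_dist_of_mem_ball {a b u v : X} {r s : ℝ} (hu : u ∈ Metric.ball a r)
    (hv : v ∈ Metric.ball b r) (h : s + 2 * r ≤ dist a b) : s ≤ dist u v := by
  have := dist_triangle4 a u v b
  rw [Metric.mem_ball] at hu hv
  rw [dist_comm a u] at this
  linarith

/-- Metric properness for balls: if `r` is small, only finitely many group elements map `(u, v, z)`
to `(u', v', z')` with `u`, `v`, `u'`, `v'` in the `r`-balls about `a`, `b`, `a'`, `b'`, and `z`, `z'`
far from these balls. -/
theorem MetricallyProper.exists_finite (hproper : MetricallyProper Γ X) {a b a' b' : X}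
    (hab : a ≠ b) (hab' : a' ≠ b') {δ : ℝ} (hδ : 0 < δ) :
    ∃ r : ℝ, 0 < r ∧ r ≤ δ ∧ {g : Γ | ∃ u v z : X, dist u a < r ∧ dist v b < r ∧ δ ≤ dist z a ∧
      δ ≤ dist z b ∧ dist (g • u) a' < r ∧ dist (g • v) b' < r ∧ δ ≤ dist (g • z) a' ∧
      δ ≤ dist (g • z) b'}.Finite := by
  set ν : ℝ := min (1 / 4) (min (δ / 4) (min (dist a b / 4) (dist a' b' / 4))) with hνdef
  have h1 : 0 < dist a b := dist_pos.2 hab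
  have h2 : 0 < dist a' b' := dist_pos.2 hab'
  have hν : 0 < ν := by positivity
  have hν1 : ν ≤ 1 / 4 := min_le_left _ _
  have hν2 : ν ≤ δ / 4 := (min_le_right _ _).trans (min_le_left _ _)
  have hν3 : ν ≤ dist a b / 4 := (min_le_right _ _).trans ((min_le_right _ _).trans (min_le_left _ _))
  have hν4 : ν ≤ dist a' b' / 4 :=
    (min_le_right _ _).trans ((min_le_right _ _).trans (min_le_right _ _))
  obtain ⟨m, R, -, -, hP⟩ := hproper ν hν (by linarith)
  have hR := Real.exp_pos (-R)
  set r : ℝ := min ν (Real.exp (-R) / 2) with hrdef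
  have hr : 0 < r := by positivity
  have hrν : r ≤ ν := min_le_left _ _
  have hrR : 2 * r ≤ Real.exp (-R) := by
    have : r ≤ Real.exp (-R) / 2 := min_le_right _ _
    linarith
  have hdiam : ∀ x : X, Metric.diam (Metric.ball x r) ≤ Real.exp (-R) := fun x =>
    (Metric.diam_ball hr.le).trans hrR
  have hfin := (hP (Metric.ball a r) (Metric.ball b r) Metric.isOpen_ball Metric.isOpen_ball
    (fun u hu v hv => le_dist_of_mem_ball hu hv (by linarith)) (hdiam a) (hdiam b)).2
    (Metric.ball a' r) (Metric.ball b' r) Metric.isOpen_ball Metric.isOpen_ball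
    (fun u hu v hv => le_dist_of_mem_ball hu hv (by linarith)) (hdiam a') (hdiam b')
  refine ⟨r, hr, by linarith, (finite_of_encard_le_coe hfin).subset ?_⟩
  rintro g ⟨u, v, z, hu, hv, hza, hzb, hgu, hgv, hgza, hgzb⟩
  exact ⟨u, hu, v, hv, z, lt_infDist_union_ball hν hr hrν (by linarith) (by linarith), hgu, hgv,
    lt_infDist_union_ball hν hr hrν (by linarith) (by linarith)⟩

/-- The orbit of the pair of fixed points of an element with north-south dynamics is closed in the
space of pairs of distinct points. A translate of the pair close to `(a', b')` extends, by moving a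
third point into a fundamental domain of `g`, to a translate of a well separated triple. -/
theorem exists_orbit_avoid (hX : ∀ x : X, (𝓝[≠] x).NeBot) (hproper : MetricallyProper Γ X)
    {g : Γ} {a b a' b' : X} (hg : NorthSouth g a b) (hab' : a' ≠ b')
    (hne : ∀ γ : Γ, ¬ (γ • a = a' ∧ γ • b = b')) :
    ∃ r : ℝ, 0 < r ∧ ∀ γ : Γ, ¬ (dist (γ • a) a' < r ∧ dist (γ • b) b' < r) := by
  obtain ⟨hab, ha, hb, -, δ, hδ, hU⟩ := hg
  obtain ⟨z, hza, hzb⟩ := exists_ne_ne hX a' b'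
  have h1 : 0 < dist z a' := dist_pos.2 hza
  have h2 : 0 < dist z b' := dist_pos.2 hzb
  obtain ⟨r, hr, hrδ, hfin⟩ := hproper.exists_finite hab hab' (δ := min δ (min (dist z a') (dist z b')))
    (by positivity)
  have hr1 : r ≤ dist z a' := hrδ.trans ((min_le_right _ _).trans (min_le_left _ _))
  have hr2 : r ≤ dist z b' := hrδ.trans ((min_le_right _ _).trans (min_le_right _ _))
  have hopen : {p : X × X | p ∉ (fun γ : Γ => (γ • a, γ • b)) '' {g : Γ | ∃ u v z_1 : X,
      dist u a < r ∧ dist v b < r ∧ min δ (min (dist z a') (dist z b')) ≤ dist z_1 a ∧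
      min δ (min (dist z a') (dist z b')) ≤ dist z_1 b ∧ dist (g • u) a' < r ∧ dist (g • v) b' < r ∧
      min δ (min (dist z a') (dist z b')) ≤ dist (g • z_1) a' ∧
      min δ (min (dist z a') (dist z b')) ≤ dist (g • z_1) b'}} ∈ 𝓝 (a', b') := by
    refine (hfin.image _).isClosed.isOpen_compl.mem_nhds ?_
    rintro ⟨γ, -, hγ⟩
    exact hne γ (by simpa using hγ)
  obtain ⟨s, hs, hsub⟩ := Metric.mem_nhds_iff.1 hopen
  refine ⟨min r s, lt_min hr hs, fun γ ⟨hγa, hγb⟩ => ?_⟩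
  have hmem : γ⁻¹ • z ∈ ({a, b}ᶜ : Set X) := by
    rintro (h | h)
    · rw [inv_smul_eq_iff] at h
      rw [← h] at hγa
      exact absurd (hγa.trans_le (min_le_left _ _)) (not_lt.2 hr1)
    · rw [mem_singleton_iff, inv_smul_eq_iff] at h
      rw [← h] at hγb
      exact absurd (hγb.trans_le (min_le_left _ _)) (not_lt.2 hr2)
  rw [← hU, mem_iUnion] at hmem
  obtain ⟨i, ζ, hζ, hζz⟩ := hmem
  simp only [mem_compl_iff, mem_union, Metric.mem_ball, not_or, not_lt] at hζ
  have hfix : ∀ c : X, g • c = c → g ^ i • c = c := fun c hc =>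
    MulAction.mem_stabilizer_iff.1 (zpow_mem (MulAction.mem_stabilizer_iff.2 hc) i)
  have e1 : (γ * g ^ i) • a = γ • a := by rw [mul_smul, hfix a ha]
  have e2 : (γ * g ^ i) • b = γ • b := by rw [mul_smul, hfix b hb]
  have e3 : (γ * g ^ i) • ζ = z := by
    rw [mul_smul]
    simp only at hζz
    rw [hζz, smul_inv_smul]
  have hball : (γ • a, γ • b) ∈ Metric.ball (a', b') s := by
    rw [Metric.mem_ball, Prod.dist_eq]
    exact max_lt (hγa.trans_le (min_le_right _ _)) (hγb.trans_le (min_le_right _ _))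
  refine hsub hball ⟨γ * g ^ i, ⟨a, b, ζ, by simpa, by simpa, (min_le_left _ _).trans hζ.1,
    (min_le_left _ _).trans hζ.2, ?_, ?_, ?_, ?_⟩, by simp only [e1, e2]⟩
  · rw [e1]; exact hγa.trans_le (min_le_left _ _)
  · rw [e2]; exact hγb.trans_le (min_le_left _ _)
  · rw [e3]; exact (min_le_right _ _).trans (min_le_left _ _)
  · rw [e3]; exact (min_le_right _ _).trans (min_le_right _ _)

theorem exists_nhds_forall_notMem {Y : Type*} [TopologicalSpace Y] [T2Space Y] {φ : Y → Y}
    (hφ : Continuous φ) {c : Y} (hc : φ c ≠ c) : ∃ O ∈ 𝓝 c, ∀ p ∈ O, φ p ∉ O := by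
  obtain ⟨A, A', hA, hA', hd⟩ := t2_separation_nhds hc
  refine ⟨A' ∩ φ ⁻¹' A, inter_mem hA' (hφ.continuousAt.preimage_mem_nhds hA), ?_⟩
  rintro p ⟨-, hp⟩ ⟨hp', -⟩
  exact disjoint_left.1 hd hp hp'

theorem continuous_tripleFlip : Continuous (tripleFlip : X × X × X → X × X × X) := by
  unfold tripleFlip; fun_prop

/-- The finitely many elements that can move a small ball about the triple `(a, b, z)` to meet
itself or its image under `ι`. -/
theorem MetricallyProper.exists_finite_triple (hproper : MetricallyProper Γ X) {a b z : X}
    (hab : a ≠ b) (haz : z ≠ a) (hbz : z ≠ b) :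
    ∃ r : ℝ, 0 < r ∧ {g : Γ | ∃ q ∈ Metric.ball (a, b, z) r,
      g • q ∈ Metric.ball (a, b, z) r ∨ g • tripleFlip q ∈ Metric.ball (a, b, z) r}.Finite := by
  have h1 : 0 < dist z a := dist_pos.2 haz
  have h2 : 0 < dist z b := dist_pos.2 hbz
  set δ := min (dist z a) (dist z b) / 2 with hδdef
  have hδ : 0 < δ := by positivity
  have hδa : 2 * δ ≤ dist z a := by rw [hδdef]; linarith [min_le_left (dist z a) (dist z b)]
  have hδb : 2 * δ ≤ dist z b := by rw [hδdef]; linarith [min_le_right (dist z a) (dist z b)]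
  obtain ⟨r₁, hr₁, hr₁δ, hf₁⟩ := hproper.exists_finite hab hab hδ
  obtain ⟨r₂, hr₂, hr₂δ, hf₂⟩ := hproper.exists_finite hab.symm hab hδ
  refine ⟨min r₁ r₂, lt_min hr₁ hr₂, (hf₁.union hf₂).subset ?_⟩
  have hdist : ∀ w c : X, dist w z < min r₁ r₂ → 2 * δ ≤ dist z c → δ ≤ dist w c := by
    intro w c hw hc
    have := dist_triangle z w c
    rw [dist_comm z w] at this
    linarith [min_le_left r₁ r₂]
  have hmem : ∀ p : X × X × X, p ∈ Metric.ball (a, b, z) (min r₁ r₂) →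
      dist p.1 a < min r₁ r₂ ∧ dist p.2.1 b < min r₁ r₂ ∧ dist p.2.2 z < min r₁ r₂ := by
    intro p hp
    rw [Metric.mem_ball, Prod.dist_eq, Prod.dist_eq, max_lt_iff, max_lt_iff] at hp
    exact hp
  rintro g ⟨q, hq, h | h⟩
  · left
    obtain ⟨q1, q2, q3⟩ := hmem q hq
    obtain ⟨p1, p2, p3⟩ := hmem _ h
    exact ⟨q.1, q.2.1, q.2.2, q1.trans_le (min_le_left _ _), q2.trans_le (min_le_left _ _),
      hdist _ _ q3 hδa, hdist _ _ q3 hδb, p1.trans_le (min_le_left _ _),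
      p2.trans_le (min_le_left _ _), hdist _ _ p3 hδa, hdist _ _ p3 hδb⟩
  · right
    obtain ⟨q1, q2, q3⟩ := hmem q hq
    obtain ⟨p1, p2, p3⟩ := hmem _ h
    exact ⟨q.2.1, q.1, q.2.2, q2.trans_le (min_le_right _ _), q1.trans_le (min_le_right _ _),
      hdist _ _ q3 hδb, hdist _ _ q3 hδa, p1.trans_le (min_le_right _ _),
      p2.trans_le (min_le_right _ _), hdist _ _ p3 hδa, hdist _ _ p3 hδb⟩

/-- Arbitrarily small boxes about `(a, b, z)` that satisfy the embedding condition: by properness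
only the finite stabilizer of the triple has to be respected, and the box is made invariant
under it. -/
theorem MetricallyProper.exists_embedded_box [ContinuousConstSMul Γ X]
    (hproper : MetricallyProper Γ X) {a b z : X} (hab : a ≠ b) (haz : z ≠ a) (hbz : z ≠ b)
    (hflip : ∀ γ : Γ, ¬ (γ • a = b ∧ γ • b = a)) {r₀ : ℝ} (hr₀ : 0 < r₀) :
    ∃ U V W : Set X, IsOpen U ∧ IsOpen V ∧ IsOpen W ∧ a ∈ U ∧ b ∈ V ∧ z ∈ W ∧
      U ⊆ Metric.ball a r₀ ∧ V ⊆ Metric.ball b r₀ ∧ W ⊆ Metric.ball z r₀ ∧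
      (∀ g : Γ, (fun p : X × X × X => g • p) '' (U ×ˢ V ×ˢ W) = U ×ˢ V ×ˢ W ∨
        Disjoint ((fun p : X × X × X => g • p) '' flipHull (U ×ˢ V ×ˢ W))
          (flipHull (U ×ˢ V ×ˢ W))) ∧
      Finite (fixingSubgroup Γ (U ∪ V ∪ W)) := by
  set c : X × X × X := (a, b, z) with hc
  obtain ⟨r₁, hr₁, hS⟩ := hproper.exists_finite_triple hab haz hbz
  set S : Set Γ := {g : Γ | ∃ q ∈ Metric.ball c r₁,
      g • q ∈ Metric.ball c r₁ ∨ g • tripleFlip q ∈ Metric.ball c r₁} with hSdef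
  set K : Subgroup Γ := MulAction.stabilizer Γ c with hK
  -- The finite stabilizer of the triple; `T y` below is the part of a ball that stays in it under `K`.
  have hKS : (K : Set Γ) ⊆ S := fun g hg => by
    refine ⟨c, Metric.mem_ball_self hr₁, Or.inl ?_⟩
    rw [MulAction.mem_stabilizer_iff.1 hg]
    exact Metric.mem_ball_self hr₁
  have hKfin : Finite K := (hS.subset hKS).to_subtype
  have hO : ∀ g ∈ S \ K, ∃ O ∈ 𝓝 c, ∀ p ∈ O, g • p ∉ O ∧ g • tripleFlip p ∉ O := by
    intro g hg
    have h1 : g • c ≠ c := fun h => hg.2 (MulAction.mem_stabilizer_iff.2 h)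
    have h2 : g • tripleFlip c ≠ c := fun h => by
      have e1 := congrArg Prod.fst h
      have e2 := congrArg (fun p => p.2.1) h
      exact hflip g ⟨e2, e1⟩
    obtain ⟨O₁, hO₁, hO₁'⟩ := exists_nhds_forall_notMem (continuous_const_smul g) h1
    obtain ⟨O₂, hO₂, hO₂'⟩ := exists_nhds_forall_notMem
      (φ := fun p => g • tripleFlip p) (continuous_tripleFlip.const_smul g) h2
    exact ⟨O₁ ∩ O₂, inter_mem hO₁ hO₂, fun p hp => ⟨fun h => hO₁' p hp.1 h.1,
      fun h => hO₂' p hp.2 h.2⟩⟩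
  choose! O hO hOp using hO
  have hOall : (⋂ g ∈ S \ K, O g) ∩ Metric.ball c r₁ ∈ 𝓝 c :=
    inter_mem ((biInter_mem (hS.subset sdiff_subset)).2 hO) (Metric.ball_mem_nhds c hr₁)
  obtain ⟨r₂, hr₂, hsub⟩ := Metric.nhds_basis_closedBall.mem_iff.1 hOall
  set r := min r₀ r₂ with hr
  have hrpos : 0 < r := lt_min hr₀ hr₂
  let T : X → Set X := fun y => {u | ∀ h : K, (h : Γ) • u ∈ Metric.ball y r}
  have hTopen : ∀ y, IsOpen (T y) := fun y => by
    have : T y = ⋂ h : K, (fun u => (h : Γ) • u) ⁻¹' Metric.ball y r := by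
      ext u; simp [T]
    rw [this]
    exact isOpen_iInter_of_finite fun h => Metric.isOpen_ball.preimage (continuous_const_smul _)
  have hTball : ∀ y, T y ⊆ Metric.ball y r := fun y u hu => by simpa using hu 1
  have hTinv : ∀ y, ∀ g ∈ K, ∀ u ∈ T y, g • u ∈ T y := fun y g hg u hu h => by
    rw [← mul_smul]
    exact hu (h * ⟨g, hg⟩)
  have hKfix : ∀ h : K, (h : Γ) • a = a ∧ (h : Γ) • b = b ∧ (h : Γ) • z = z := fun h => by
    have := MulAction.mem_stabilizer_iff.1 h.2
    rw [hc] at this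
    simpa using this
  have hmem : ∀ y, (∀ h : K, (h : Γ) • y = y) → y ∈ T y := fun y hy h => by
    rw [hy h]; exact Metric.mem_ball_self hrpos
  have hr0 : ∀ y, T y ⊆ Metric.ball y r₀ := fun y =>
    (hTball y).trans (Metric.ball_subset_ball (min_le_left _ _))
  have ha := hmem a fun h => (hKfix h).1
  have hb := hmem b fun h => (hKfix h).2.1
  have hz := hmem z fun h => (hKfix h).2.2
  refine ⟨T a, T b, T z, hTopen a, hTopen b, hTopen z, ha, hb, hz, hr0 a, hr0 b, hr0 z,
    fun g => ?_, ?_⟩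
  · by_cases hg : g ∈ K
    · left
      have hmaps : ∀ g ∈ K, ∀ p ∈ T a ×ˢ T b ×ˢ T z, g • p ∈ T a ×ˢ T b ×ˢ T z :=
        fun g hg p hp => ⟨hTinv a g hg _ hp.1, hTinv b g hg _ hp.2.1, hTinv z g hg _ hp.2.2⟩
      refine Subset.antisymm ?_ fun p hp => ⟨g⁻¹ • p, hmaps _ (inv_mem hg) p hp, smul_inv_smul g p⟩
      rintro _ ⟨p, hp, rfl⟩
      exact hmaps g hg p hp
    · right
      have hcl : closure (T a ×ˢ T b ×ˢ T z) ⊆ Metric.closedBall c r₂ := by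
        refine closure_minimal ?_ Metric.isClosed_closedBall
        rintro p ⟨h1, h2, h3⟩
        have := max_lt (Metric.mem_ball.1 (hTball a h1))
          (max_lt (Metric.mem_ball.1 (hTball b h2)) (Metric.mem_ball.1 (hTball z h3)))
        rw [Metric.mem_closedBall, Prod.dist_eq, Prod.dist_eq]
        exact this.le.trans (min_le_right _ _)
      have hno : ∀ q ∈ closure (T a ×ˢ T b ×ˢ T z), ∀ q' ∈ closure (T a ×ˢ T b ×ˢ T z),
          g • q ≠ q' ∧ g • tripleFlip q ≠ q' := by
        intro q hq q' hq'
        have m1 := hsub (hcl hq)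
        have m2 := hsub (hcl hq')
        by_cases hgS : g ∈ S
        · have n1 := mem_iInter₂.1 m1.1 g ⟨hgS, hg⟩
          have n2 := mem_iInter₂.1 m2.1 g ⟨hgS, hg⟩
          have := hOp g ⟨hgS, hg⟩ q n1
          exact ⟨fun h => this.1 (h ▸ n2), fun h => this.2 (h ▸ n2)⟩
        · exact ⟨fun h => hgS ⟨q, m1.2, Or.inl (h ▸ m2.2)⟩,
            fun h => hgS ⟨q, m1.2, Or.inr (h ▸ m2.2)⟩⟩
      rw [disjoint_left]
      rintro _ ⟨p, hp, rfl⟩ hp'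
      rcases hp with hp | ⟨q, hq, rfl⟩ <;> rcases hp' with hp' | ⟨q', hq', he⟩
      · exact (hno p hp _ hp').1 rfl
      · refine (hno p hp q' hq').2 ?_
        rw [smul_tripleFlip]
        exact (congrArg tripleFlip he).symm
      · exact (hno q hq _ hp').2 rfl
      · refine (hno q hq q' hq').1 ?_
        have := congrArg tripleFlip he
        rw [tripleFlip_tripleFlip] at this
        rw [this]
        rfl
  · refine Finite.of_injective (β := K) (fun g => ⟨g.1, ?_⟩) fun g g' h =>
      Subtype.ext (Subtype.mk.inj h)
    · have hg := (mem_fixingSubgroup_iff Γ).1 g.2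
      rw [hK, MulAction.mem_stabilizer_iff, hc]
      simp only [Prod.smul_mk]
      rw [hg a (Or.inl (Or.inl ha)), hg b (Or.inl (Or.inr hb)), hg z (Or.inr hz)]


/-- All sufficiently small boxes about a triple of distinct points satisfy the metric requirements. -/
theorem exists_hyperbolicBox (hX : ∀ x : X, (𝓝[≠] x).NeBot) (hweak : WeaklyHyperbolic Γ X)
    (hproper : MetricallyProper Γ X) {a b z : X} (hab : a ≠ b) (haz : z ≠ a) (hbz : z ≠ b) :
    ∃ (ν : ℝ) (m : ℕ) (R ε β r : ℝ), 0 < r ∧ 0 < ν ∧ ν < 1 / 2 ∧ IsProperConstants Γ X ν m R ∧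
      ∀ U V W : Set X, IsOpen U → IsOpen V → U ⊆ Metric.ball a r → V ⊆ Metric.ball b r →
        W ⊆ Metric.ball z r →
        (∀ u ∈ U, ∀ v ∈ V, 4 * ν ≤ dist u v) ∧ (∀ u ∈ U, ∀ w ∈ W, 4 * ν ≤ dist u w) ∧
        (∀ v ∈ V, ∀ w ∈ W, 4 * ν ≤ dist v w) ∧
        Metric.diam U + Metric.diam V + Metric.diam W < Real.exp (-R) ∧
        ∀ o ∈ W, HyperbolicBox Γ U V o ε β ν m := by
  have d1 : 0 < dist a b := dist_pos.2 hab
  have d2 : 0 < dist z a := dist_pos.2 haz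
  have d3 : 0 < dist z b := dist_pos.2 hbz
  set δ : ℝ := min 1 (min (dist a b) (min (dist z a) (dist z b))) with hδdef
  have hδ : 0 < δ := by positivity
  have hδ1 : δ ≤ 1 := min_le_left _ _
  have hδab : δ ≤ dist a b := (min_le_right _ _).trans (min_le_left _ _)
  have hδza : δ ≤ dist z a := (min_le_right _ _).trans ((min_le_right _ _).trans (min_le_left _ _))
  have hδzb : δ ≤ dist z b := (min_le_right _ _).trans ((min_le_right _ _).trans (min_le_right _ _))
  obtain ⟨β, hβ0, -, hβ⟩ := hweak (δ / 4) (by positivity)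
  obtain ⟨m, R, hconst⟩ := hproper (δ / 12) (by positivity) (by linarith)
  have hR := Real.exp_pos (-R)
  have hnear : ∀ y : X, ∃ y₀ : X, 0 < dist y₀ y ∧ dist y₀ y < δ / 8 := fun y => by
    obtain ⟨y₀, h1, h2⟩ := (hX y).nonempty_of_mem
      (inter_mem (mem_nhdsWithin_of_mem_nhds (Metric.ball_mem_nhds y (by positivity : 0 < δ / 8)))
        self_mem_nhdsWithin)
    exact ⟨y₀, dist_pos.2 h2, h1⟩
  obtain ⟨a₀, ha₀, ha₀'⟩ := hnear a
  obtain ⟨b₀, hb₀, hb₀'⟩ := hnear b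
  set r : ℝ := min (δ / 24) (min (dist a₀ a / 2) (min (dist b₀ b / 2) (Real.exp (-R) / 8))) with hrd
  have hr : 0 < r := by positivity
  have hr1 : r ≤ δ / 24 := min_le_left _ _
  have hr2 : r ≤ dist a₀ a / 2 := (min_le_right _ _).trans (min_le_left _ _)
  have hr3 : r ≤ dist b₀ b / 2 :=
    (min_le_right _ _).trans ((min_le_right _ _).trans (min_le_left _ _))
  have hr4 : r ≤ Real.exp (-R) / 8 :=
    (min_le_right _ _).trans ((min_le_right _ _).trans (min_le_right _ _))
  refine ⟨δ / 12, m, R, δ / 4, β, r, hr, by positivity, by linarith, hconst,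
    fun U V W oU oV hU hV hW => ?_⟩
  have sUV : ∀ u ∈ U, ∀ v ∈ V, δ / 2 ≤ dist u v := fun u hu v hv =>
    le_dist_of_mem_ball (hU hu) (hV hv) (by linarith)
  have sWU : ∀ w ∈ W, ∀ u ∈ U, δ / 2 ≤ dist w u := fun w hw u hu =>
    le_dist_of_mem_ball (hW hw) (hU hu) (by linarith)
  have sWV : ∀ w ∈ W, ∀ v ∈ V, δ / 2 ≤ dist w v := fun w hw v hv =>
    le_dist_of_mem_ball (hW hw) (hV hv) (by linarith)
  have hdiam : ∀ (y : X) (A : Set X), A ⊆ Metric.ball y r → Metric.diam A ≤ 2 * r :=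
    fun y A hA => (Metric.diam_mono hA Metric.isBounded_ball).trans (Metric.diam_ball hr.le)
  have hsmall : ∀ (y : X) (A : Set X), A ⊆ Metric.ball y r → ∀ u ∈ A, ∀ u' ∈ A,
      dist u u' ≤ δ / 12 := fun y A hA u hu u' hu' => by
    have h1 := hA hu
    have h2 := hA hu'
    rw [Metric.mem_ball] at h1 h2
    have := dist_triangle_right u u' y
    linarith
  have hinner : ∀ (y y₀ : X) (A : Set X), A ⊆ Metric.ball y r → r ≤ dist y₀ y / 2 →
      0 < dist y₀ y → dist y₀ y < δ / 8 →
      ∃ η : ℝ, 0 < η ∧ ∃ u₀ : X, ∀ u ∈ A, η ≤ dist u₀ u ∧ dist u₀ u ≤ δ / 4 := by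
    intro y y₀ A hA h1 h2 h3
    refine ⟨dist y₀ y / 2, by positivity, y₀, fun u hu => ?_⟩
    have h4 := hA hu
    rw [Metric.mem_ball] at h4
    have h5 := dist_triangle y₀ u y
    have h6 := dist_triangle_right y₀ u y
    constructor <;> linarith
  have hdU := hdiam a U hU
  have hdV := hdiam b V hV
  have hdW := hdiam z W hW
  refine ⟨fun u hu v hv => by linarith [sUV u hu v hv],
    fun u hu w hw => by rw [dist_comm]; linarith [sWU w hw u hu],
    fun v hv w hw => by rw [dist_comm]; linarith [sWV w hw v hv], by linarith, fun o ho => ?_⟩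
  have hP := hconst.2.2 U V oU oV (fun u hu v hv => by linarith [sUV u hu v hv])
    (by linarith) (by linarith)
  exact
    { ε_pos := by positivity
      ε_le_one := by linarith
      b_pos := hβ0
      contract := hβ
      ν_pos := by positivity
      ν_le := by linarith
      sep_UV := fun u hu v hv => by linarith [sUV u hu v hv]
      sep_U := fun u hu => by linarith [sWU o ho u hu]
      sep_V := fun v hv => by linarith [sWV o ho v hv]
      small_U := hsmall a U hU
      small_V := hsmall b V hV
      annulus := fun j x₀ hx y₀ hy => by
        refine le_trans (encard_le_encard ?_) (hP.1 {o} (by simpa using hR.le) ?_ j x₀ y₀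
          (by linarith [sUV x₀ hx y₀ hy]))
        · rintro g ⟨h1, h2, h3, h4⟩
          exact ⟨_, h1, _, h2, o, rfl, smul_inv_smul _ _, smul_inv_smul _ _, h3, h4⟩
        · rintro w rfl u (hu | hu)
          · linarith [sWU w ho u hu]
          · linarith [sWV w ho u hu]
      far := hP.2 U V oU oV (fun u hu v hv => by linarith [sUV u hu v hv])
        (by linarith) (by linarith)
      inner_U := hinner a a₀ U hU hr2 ha₀ ha₀'
      inner_V := hinner b b₀ V hV hr3 hb₀ hb₀' }

end Orbits

/-! ### The kernel of a Hölder function -/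

theorem dist_le_of_holderOnWith {Y Z : Type*} [PseudoMetricSpace Y] [PseudoMetricSpace Z]
    {q α : ℝ≥0} {f : Y → Z} {s : Set Y} (h : HolderOnWith q α f s) {x y : Y} (hx : x ∈ s)
    (hy : y ∈ s) : dist (f x) (f y) ≤ q * dist x y ^ (α : ℝ) := by
  have := h.edist_le hx hy
  rwa [edist_dist, edist_dist, ENNReal.ofReal_rpow_of_nonneg dist_nonneg α.coe_nonneg,
    ← ENNReal.ofReal_coe_nnreal, ← ENNReal.ofReal_mul q.coe_nonneg,
    ENNReal.ofReal_le_ofReal_iff (by positivity)] at this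

namespace LeafDatum

section Mean

variable {Γ X : Type*} [Group Γ] [MetricSpace X] [MulAction Γ X] [MeasurableSpace X] [BorelSpace X]
  (D : LeafDatum Γ X)

/-- Integration with respect to `μ`, as a continuous functional on bounded continuous
functions. -/
def mean : (X →ᵇ ℝ) →L[ℝ] ℝ :=
  haveI := D.prob
  LinearMap.mkContinuous
    { toFun := fun F => ∫ w, F w ∂D.μ
      map_add' := fun F G => integral_add (F.integrable D.μ) (G.integrable D.μ)
      map_smul' := fun c F => integral_const_mul c F } 1
    fun F => by
      rw [one_mul]
      exact BoundedContinuousFunction.norm_integral_le_norm D.μ F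

theorem mean_apply (F : X →ᵇ ℝ) : D.mean F = ∫ w, F w ∂D.μ := rfl

theorem abs_mean_le (F : X →ᵇ ℝ) : |D.mean F| ≤ ‖F‖ := by
  have := D.prob
  exact BoundedContinuousFunction.norm_integral_le_norm D.μ F

end Mean

section

variable {Γ X : Type*} [Group Γ] [MetricSpace X] [BoundedSpace X] [MulAction Γ X]
  [MeasurableSpace X] (D : LeafDatum Γ X)

theorem exists_abs_le (f : D.holderFunctions) : ∃ K : ℝ, ∀ p, |f.1 p| ≤ K := by
  obtain ⟨-, hsupp, q, α, -, -, hf⟩ := f.2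
  obtain ⟨B, hB⟩ := Metric.isBounded_iff.1 (BoundedSpace.bounded_univ (α := X × X × X))
  by_cases hC : D.C.Nonempty
  · obtain ⟨p₀, hp₀⟩ := hC
    refine ⟨|f.1 p₀| + q * B ^ (α : ℝ), fun p => ?_⟩
    have hB0 : 0 ≤ B := dist_nonneg.trans (hB (mem_univ p₀) (mem_univ p₀))
    by_cases hp : p ∈ D.C
    · have h1 := dist_le_of_holderOnWith hf hp hp₀
      rw [Real.dist_eq] at h1
      have h2 : dist p p₀ ^ (α : ℝ) ≤ B ^ (α : ℝ) :=
        Real.rpow_le_rpow dist_nonneg (hB (mem_univ _) (mem_univ _)) α.coe_nonneg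
      have h3 := abs_sub_abs_le_abs_sub (f.1 p) (f.1 p₀)
      have h4 := mul_le_mul_of_nonneg_left h2 q.coe_nonneg
      linarith
    · rw [hsupp p hp, abs_zero]
      positivity
  · exact ⟨0, fun p => by rw [hsupp p fun hp => hC ⟨p, hp⟩, abs_zero]⟩

/-- The function `w ↦ ψ (u, v) f (u, v, w)`, as a bounded continuous function depending on the
pair `(u, v)`. -/
def kernel (f : D.holderFunctions) (u v : X) : X →ᵇ ℝ :=
  D.ψ (u, v) • BoundedContinuousFunction.ofNormedAddCommGroup (fun w => f.1 (u, v, w))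
    (f.2.1.comp (by fun_prop)) (D.exists_abs_le f).choose
    fun w => (D.exists_abs_le f).choose_spec (u, v, w)

@[simp] theorem kernel_apply (f : D.holderFunctions) (u v w : X) :
    D.kernel f u v w = D.ψ (u, v) * f.1 (u, v, w) := rfl

theorem kernel_add (f f' : D.holderFunctions) (u v : X) :
    D.kernel (f + f') u v = D.kernel f u v + D.kernel f' u v := by
  ext w; simp [mul_add]

theorem kernel_smul (c : ℝ) (f : D.holderFunctions) (u v : X) :
    D.kernel (c • f) u v = c • D.kernel f u v := by
  ext w
  simp only [kernel_apply, BoundedContinuousFunction.coe_smul, Submodule.coe_smul, Pi.smul_apply,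
    smul_eq_mul]
  ring

/-- The product `ψ f` is Hölder continuous in the pair `(u, v)`, uniformly in `w`, also across the
boundary of the box, where `ψ` vanishes continuously. -/
theorem exists_abs_kernel_sub_le (f : D.holderFunctions) :
    ∃ L α : ℝ, 0 < α ∧ 0 ≤ L ∧ ∀ p p' : X × X, dist p p' ≤ 1 →
      ‖D.kernel f p.1 p.2 - D.kernel f p'.1 p'.2‖ ≤ L * dist p p' ^ α := by
  obtain ⟨K, hK⟩ := D.exists_abs_le f
  obtain ⟨-, hsupp, q, α, hα, -, hf⟩ := f.2
  obtain ⟨q', α', hα', -, hψ⟩ := D.ψ_holder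
  have hψd : ∀ p p', |D.ψ p - D.ψ p'| ≤ q' * dist p p' ^ (α' : ℝ) := fun p p' => by
    rw [← Real.dist_eq]
    exact dist_le_of_holderOnWith (hψ.holderOnWith univ) (mem_univ _) (mem_univ _)
  have hψ1 : ∀ p, |D.ψ p| ≤ 1 := fun p => by
    rw [abs_of_nonneg (D.ψ_mem p).1]; exact (D.ψ_mem p).2
  refine ⟨q + q' * |K|, min α α', lt_min hα hα', by positivity, fun p p' hd => ?_⟩
  have hd0 : 0 ≤ dist p p' := dist_nonneg
  rcases hd0.eq_or_lt with h0 | hdpos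
  · rw [dist_eq_zero.1 h0.symm, sub_self, norm_zero]
    positivity
  have hpow1 : dist p p' ^ (α : ℝ) ≤ dist p p' ^ (min (α : ℝ) α') :=
    Real.rpow_le_rpow_of_exponent_ge hdpos hd (min_le_left _ _)
  have hpow2 : dist p p' ^ (α' : ℝ) ≤ dist p p' ^ (min (α : ℝ) α') :=
    Real.rpow_le_rpow_of_exponent_ge hdpos hd (min_le_right _ _)
  have hnn : 0 ≤ dist p p' ^ (min (α : ℝ) α') := by positivity
  have hψd' := (hψd p p').trans (mul_le_mul_of_nonneg_left hpow2 q'.coe_nonneg)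
  rw [BoundedContinuousFunction.norm_le (by positivity)]
  intro w
  simp only [BoundedContinuousFunction.coe_sub, Pi.sub_apply, kernel_apply, Prod.mk.eta]
  have hfK : ∀ u v : X, |f.1 (u, v, w)| ≤ |K| := fun u v => (hK _).trans (le_abs_self K)
  rw [Real.norm_eq_abs]
  have hprod : ∀ x y : ℝ, |x| ≤ q' * dist p p' ^ (min (α : ℝ) α') → |y| ≤ |K| →
      |x * y| ≤ q' * |K| * dist p p' ^ (min (α : ℝ) α') := fun x y hx hy => by
    rw [abs_mul]
    refine (mul_le_mul hx hy (abs_nonneg _) (by positivity)).trans (le_of_eq (by ring))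
  have hq0 : 0 ≤ q * dist p p' ^ (min (α : ℝ) α') := by positivity
  have hout : ∀ p : X × X, (p.1, p.2, w) ∉ D.C → w ∈ D.W → D.ψ p = 0 := fun p hp hw =>
    D.ψ_supp p fun h => hp ⟨h.1, h.2, hw⟩
  by_cases hw : w ∈ D.W
  · by_cases h1 : (p.1, p.2, w) ∈ D.C
    · by_cases h2 : (p'.1, p'.2, w) ∈ D.C
      · have e : D.ψ p * f.1 (p.1, p.2, w) - D.ψ p' * f.1 (p'.1, p'.2, w) =
            D.ψ p * (f.1 (p.1, p.2, w) - f.1 (p'.1, p'.2, w)) +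
              (D.ψ p - D.ψ p') * f.1 (p'.1, p'.2, w) := by ring
        have h3 := dist_le_of_holderOnWith hf h1 h2
        have h4 : dist (p.1, p.2, w) (p'.1, p'.2, w) = dist p p' := by
          simp [Prod.dist_eq]
        rw [h4, Real.dist_eq] at h3
        have h5 := h3.trans (mul_le_mul_of_nonneg_left hpow1 q.coe_nonneg)
        rw [e]
        refine (abs_add_le _ _).trans ?_
        have h6 := hprod _ _ hψd' (hfK p'.1 p'.2)
        have h7 : |D.ψ p * (f.1 (p.1, p.2, w) - f.1 (p'.1, p'.2, w))| ≤
            q * dist p p' ^ (min (α : ℝ) α') := by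
          rw [abs_mul]
          exact (mul_le_of_le_one_left (abs_nonneg _) (hψ1 p)).trans h5
        rw [add_mul]
        linarith
      · have h3 := hprod _ _ hψd' (hfK p.1 p.2)
        rw [hout p' h2 hw, sub_zero] at h3
        rw [hsupp _ h2, mul_zero, sub_zero, add_mul]
        linarith
    · have h3 := hprod _ _ hψd' (hfK p'.1 p'.2)
      rw [hout p h1 hw, zero_sub, neg_mul, abs_neg] at h3
      rw [hsupp _ h1, mul_zero, zero_sub, abs_neg, add_mul]
      linarith
  · rw [hsupp _ fun h => hw h.2.2, hsupp _ fun h => hw h.2.2, mul_zero, mul_zero, sub_zero, abs_zero]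
    positivity

theorem holderKernel (f : D.holderFunctions) : HolderKernel D.U D.V (D.kernel f) where
  supp u v huv := by
    rw [kernel, D.ψ_supp (u, v) huv, zero_smul]
  bdd := by
    obtain ⟨K, hK⟩ := D.exists_abs_le f
    refine ⟨|K|, fun u v => (BoundedContinuousFunction.norm_le (abs_nonneg K)).2 fun w => ?_⟩
    rw [kernel_apply, Real.norm_eq_abs, abs_mul, abs_of_nonneg (D.ψ_mem _).1]
    exact (mul_le_of_le_one_left (abs_nonneg _) (D.ψ_mem _).2).trans ((hK _).trans (le_abs_self K))
  holder := by
    obtain ⟨L, α, hα, hL, h⟩ := D.exists_abs_kernel_sub_le f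
    refine ⟨L, α, hα, fun u v t hvt => ?_, fun u v t hvt => ?_⟩
    · have e : dist (u, v) (u, t) = dist v t := by simp [Prod.dist_eq]
      rw [← e] at hvt ⊢
      exact h (u, v) (u, t) hvt
    · have e : dist (v, u) (t, u) = dist v t := by simp [Prod.dist_eq]
      rw [← e] at hvt ⊢
      exact h (v, u) (t, u) hvt

theorem legTerm_kernel_eq_zero {p q : X} (h : ∀ γ : Γ, ¬ (γ • p ∈ D.U ∧ γ • q ∈ D.V))
    (h' : ∀ γ : Γ, ¬ (γ • q ∈ D.U ∧ γ • p ∈ D.V)) (f : D.holderFunctions) (k : Γ) :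
    legTerm (D.kernel f) k p q = 0 := by
  rw [legTerm, (D.holderKernel f).supp _ _ (h k⁻¹), (D.holderKernel f).supp _ _ (h' k⁻¹), sub_zero]

theorem legTerm_kernel_add (f f' : D.holderFunctions) (k : Γ) (p q : X) :
    legTerm (D.kernel (f + f')) k p q = legTerm (D.kernel f) k p q + legTerm (D.kernel f') k p q := by
  simp only [legTerm, kernel_add]; abel

theorem legTerm_kernel_smul (c : ℝ) (f : D.holderFunctions) (k : Γ) (p q : X) :
    legTerm (D.kernel (c • f)) k p q = c • legTerm (D.kernel f) k p q := by
  simp only [legTerm, kernel_smul, smul_sub]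

theorem piece_eq (f : D.holderFunctions) (p q : X) (E : Set X) (k : Γ) :
    D.piece f.1 p q E k = ∫ w in {w : X | k • w ∈ E}, legTerm (D.kernel f) k p q w ∂D.μ := by
  simp [piece, legTerm]

theorem norm_piece_le (f : D.holderFunctions) (p q : X) (E : Set X) (k : Γ) :
    ‖D.piece f.1 p q E k‖ ≤ ‖legTerm (D.kernel f) k p q‖ := by
  have := D.prob
  rw [piece_eq]
  refine (norm_setIntegral_le_of_norm_le_const (measure_lt_top _ _)
    fun w _ => (legTerm (D.kernel f) k p q).norm_coe_le_norm w).trans ?_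
  exact mul_le_of_le_one_right (norm_nonneg _) measureReal_le_one

/-- If `k (C ∪ ι C)` contributes to the leaf through `p` and `q`, then `k W` stays away from `p`
and `q`. -/
theorem le_dist_of_legTerm_ne_zero (f : D.holderFunctions) {p q : X} {k : Γ}
    (h : legTerm (D.kernel f) k p q ≠ 0) :
    ∀ w ∈ D.W, 4 * D.ν ≤ dist w (k⁻¹ • p) ∧ 4 * D.ν ≤ dist w (k⁻¹ • q) := by
  intro w hw
  have : (k⁻¹ • p ∈ D.U ∧ k⁻¹ • q ∈ D.V) ∨ (k⁻¹ • q ∈ D.U ∧ k⁻¹ • p ∈ D.V) := by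
    by_contra hcon
    rw [not_or] at hcon
    apply h
    rw [legTerm, (D.holderKernel f).supp _ _ hcon.1, (D.holderKernel f).supp _ _ hcon.2, sub_zero]
  rw [dist_comm w, dist_comm w]
  rcases this with ⟨h1, h2⟩ | ⟨h1, h2⟩
  · exact ⟨D.sep_UW _ h1 w hw, D.sep_VW _ h2 w hw⟩
  · exact ⟨D.sep_VW _ h2 w hw, D.sep_UW _ h1 w hw⟩

variable [BorelSpace X]

theorem piece_eq_mean (f : D.holderFunctions) {p q : X} {E : Set X} {k : Γ}
    (h : legTerm (D.kernel f) k p q ≠ 0 → ∀ w ∈ D.W, k • w ∈ E) :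
    D.piece f.1 p q E k = D.mean (legTerm (D.kernel f) k p q) := by
  rw [piece_eq, mean_apply]
  by_cases h0 : legTerm (D.kernel f) k p q = 0
  · simp [h0]
  · rw [Measure.restrict_eq_self_of_ae_mem]
    filter_upwards [measure_eq_zero_iff_ae_notMem.1 D.μ_compl] with w hw
    exact h h0 w (not_not.1 hw)

/-- Each translate of the box is disjoint from `A ∪ g A` once the ball `A` is small. -/
theorem eventually_piece_eq_mean [ContinuousConstSMul Γ X] (f : D.holderFunctions) (g k : Γ) :
    ∀ᶠ r in 𝓝[>] (0 : ℝ), D.piece f.1 D.x (g • D.x) (D.region g r) k =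
      D.mean (legTerm (D.kernel f) k D.x (g • D.x)) := by
  have hball : ∀ h : Γ, ∀ᶠ r in 𝓝[>] (0 : ℝ), ∀ z ∈ Metric.closedBall D.x r,
      dist (h • z) (h • D.x) < 4 * D.ν := fun h => by
    have hcont : Tendsto (fun z => h • z) (𝓝 D.x) (𝓝 (h • D.x)) :=
      (continuous_const_smul h).continuousAt
    have hν : 0 < 4 * D.ν := by linarith [D.ν_pos]
    obtain ⟨s, hs, hsub⟩ := Metric.mem_nhds_iff.1 (hcont (Metric.ball_mem_nhds _ hν))
    filter_upwards [Ioo_mem_nhdsGT hs] with r hr z hz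
    exact hsub (Metric.closedBall_subset_ball hr.2 hz)
  filter_upwards [hball k⁻¹, hball (k⁻¹ * g)] with r h1 h2
  refine D.piece_eq_mean f fun hne w hw => ?_
  obtain ⟨d1, d2⟩ := D.le_dist_of_legTerm_ne_zero f hne w hw
  rintro (hz | ⟨z, hz, hzw⟩)
  · have := h1 _ hz
    rw [inv_smul_smul] at this
    linarith
  · have := h2 _ hz
    simp only at hzw
    rw [mul_smul, hzw, inv_smul_smul, mul_smul] at this
    linarith

end

end LeafDatum

/-! ### The quasimorphisms and their growth on cyclic subgroups -/

namespace LeafDatum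

section Psi

variable {Γ X : Type*} [Group Γ] [MetricSpace X] [BoundedSpace X] [MulAction Γ X]
  [ContinuousConstSMul Γ X] [MeasurableSpace X] [BorelSpace X] (D : LeafDatum Γ X)
  {o : X} {ε β ν : ℝ} {m : ℕ}

/-- If the leaf through the base point and some other point misses all translates of the box, then
the integrals over the leaves through `x` and `g x` converge absolutely, without regularisation near
the ends, and define quasimorphisms. -/
theorem exists_psi (B : HyperbolicBox Γ D.U D.V o ε β ν m) {y : X} (hxy : D.x ≠ y)
    (h0 : ∀ (f : D.holderFunctions) (k : Γ), legTerm (D.kernel f) k D.x y = 0) :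
    ∃ Ψ : D.holderFunctions →ₗ[ℝ] quasimorphisms Γ, (∀ f, D.IsPsi f.1 (Ψ f).1) ∧
      ∀ f g, (Ψ f).1 g = (Nat.card (fixingSubgroup Γ (D.U ∪ D.V ∪ D.W)) : ℝ)⁻¹ *
        D.mean (∑' k : Γ, legTerm (D.kernel f) k D.x (g • D.x)) := by
  have hS := fun (f : D.holderFunctions) (g : Γ) =>
    B.summable_legTerm_orbit (D.holderKernel f) hxy (h0 f) g
  set c : ℝ := (Nat.card (fixingSubgroup Γ (D.U ∪ D.V ∪ D.W)) : ℝ)⁻¹ with hc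
  refine ⟨{ toFun := fun f => ⟨fun g => c * D.mean (∑' k : Γ, legTerm (D.kernel f) k D.x (g • D.x)),
              ?_⟩
            map_add' := fun f f' => ?_
            map_smul' := fun r f => ?_ }, fun f => ?_, fun f g => rfl⟩
  · obtain ⟨M, hM⟩ := B.exists_norm_tsum_legTerm_le (D.holderKernel f) (hS f)
    refine ⟨|c| * M, fun g h => ?_⟩
    rw [← mul_add, ← mul_sub, ← map_add, ← map_sub, abs_mul]
    exact mul_le_mul_of_nonneg_left ((D.abs_mean_le _).trans (hM g h)) (abs_nonneg c)
  · ext g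
    simp only [Submodule.coe_add, Pi.add_apply, legTerm_kernel_add]
    rw [(hS f g).of_norm.tsum_add (hS f' g).of_norm, map_add, mul_add]
  · ext g
    simp only [SetLike.val_smul, Pi.smul_apply, legTerm_kernel_smul, RingHom.id_apply, smul_eq_mul]
    rw [(hS f g).of_norm.tsum_const_smul, map_smul, smul_eq_mul]
    ring
  · refine fun g => ⟨fun hg => ?_, fun hg => ⟨fun r _ => ?_, ?_⟩⟩
    · simp [hg]
    · exact Summable.of_norm_bounded (hS f g) fun k => D.norm_piece_le f _ _ _ k
    · refine Tendsto.const_mul _ ?_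
      rw [D.mean.map_tsum (hS f g).of_norm]
      refine tendsto_tsum_of_dominated_convergence (hS f g) (fun k => ?_)
        (Eventually.of_forall fun r k => D.norm_piece_le f _ _ _ k)
      exact tendsto_const_nhds.congr' ((D.eventually_piece_eq_mean f g k).mono fun r h => h.symm)

/-- The quasimorphism stays bounded on the powers of an element whose fixed points span a leaf that
misses all translates of the box. -/
theorem exists_abs_mean_pow_le (B : HyperbolicBox Γ D.U D.V o ε β ν m) {y : X} (hxy : D.x ≠ y)
    (f : D.holderFunctions) (h0 : ∀ k : Γ, legTerm (D.kernel f) k D.x y = 0) {g : Γ} {a b : X}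
    (hab : a ≠ b) (ha : g • a = a) (hb : g • b = b)
    (hz : ∀ k : Γ, legTerm (D.kernel f) k a b = 0) :
    ∃ M : ℝ, ∀ n : ℕ, |D.mean (∑' k : Γ, legTerm (D.kernel f) k D.x (g ^ n • D.x))| ≤ M := by
  have hpow : ∀ c : X, g • c = c → ∀ n : ℕ, g ^ n • c = c := fun c hc n =>
    MulAction.mem_stabilizer_iff.1 (pow_mem (MulAction.mem_stabilizer_iff.2 hc) n)
  by_cases hfix : g • D.x = D.x
  · exact ⟨0, fun n => by simp [hpow _ hfix n]⟩
  have hax : a ≠ D.x := fun h => hfix (h ▸ ha)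
  obtain ⟨N, hN, Q, hQ, P, hP, hd⟩ := exists_nhds_disjoint_union hab hax
  obtain ⟨M, hM⟩ := B.exists_norm_tsum_add_le (D.holderKernel f) hxy h0 hax hP hQ hN
    (by rwa [union_comm])
  refine ⟨M, fun n => (D.abs_mean_le _).trans ?_⟩
  have h1 := (hM (g ^ n) (hpow a ha n) (hpow b hb n)).2
  simpa [indicator, hz] using h1

/-- If all translates of the box contribute nonnegatively to the leaf from `a` to `b`, and the box
itself contributes positively, then the quasimorphism tends linearly to `-∞` on the powers of some
power `h` of `g`: between a suitable neighbourhood `N` of `a` and `hⁿ N` lie the translates of the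
box by `h, h², …, hⁿ`. -/
theorem exists_mean_pow_le (B : HyperbolicBox Γ D.U D.V o ε β ν m) {y : X} (hxy : D.x ≠ y)
    (f : D.holderFunctions) (h0 : ∀ k : Γ, legTerm (D.kernel f) k D.x y = 0) {g : Γ} {a b : X}
    (hg : NorthSouth g a b) (hax : a ≠ D.x) (hoa : o ≠ a) (hob : o ≠ b)
    (hpos : ∀ (k : Γ), 0 ≤ D.mean (legTerm (D.kernel f) k a b)) :
    ∃ (j : ℕ) (M : ℝ), ∀ n : ℕ,
      D.mean (∑' k : Γ, legTerm (D.kernel f) k D.x ((g ^ j) ^ n • D.x)) ≤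
        M - n * D.mean (legTerm (D.kernel f) (1 : Γ) a b) := by
  obtain ⟨hab, ha, hb, hdyn, -⟩ := hg
  have p1 : 0 < dist a b := dist_pos.2 hab
  have p2 : 0 < dist a D.x := dist_pos.2 hax
  have p3 : 0 < dist o a := dist_pos.2 hoa
  have p4 : 0 < dist o b := dist_pos.2 hob
  obtain ⟨δ, hδ, q1, q2, q3, q4⟩ : ∃ δ : ℝ, 0 < δ ∧ 2 * δ ≤ dist a b ∧ 2 * δ ≤ dist a D.x ∧
      δ ≤ dist o a ∧ δ ≤ dist o b := by
    refine ⟨min (min (dist a b) (dist a D.x)) (min (dist o a) (dist o b)) / 2, by positivity, ?_⟩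
    have e1 := min_le_left (min (dist a b) (dist a D.x)) (min (dist o a) (dist o b))
    have e2 := min_le_right (min (dist a b) (dist a D.x)) (min (dist o a) (dist o b))
    have e3 := min_le_left (dist a b) (dist a D.x)
    have e4 := min_le_right (dist a b) (dist a D.x)
    have e5 := min_le_left (dist o a) (dist o b)
    have e6 := min_le_right (dist o a) (dist o b)
    refine ⟨?_, ?_, ?_, ?_⟩ <;> linarith
  obtain ⟨j, -, hj, -⟩ := hdyn δ hδ
  have hpow : ∀ c : X, g • c = c → ∀ n : ℕ, g ^ n • c = c := fun c hc n =>
    MulAction.mem_stabilizer_iff.1 (pow_mem (MulAction.mem_stabilizer_iff.2 hc) n)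
  obtain ⟨h, hh⟩ : ∃ h : Γ, h = g ^ j := ⟨_, rfl⟩
  have hha : h • a = a := hh ▸ hpow a ha j
  have hhb : h • b = b := hh ▸ hpow b hb j
  rw [← hh] at hj
  -- `N` is the image under `h` of the complement of a ball about `b`, so `h N ⊆ N`.
  set N : Set X := {z | h⁻¹ • z ∉ Metric.ball b δ} with hNdef
  have hNa : N ∈ 𝓝 a := by
    have : (Metric.ball b δ)ᶜ ∈ 𝓝 (h⁻¹ • a) := by
      rw [inv_smul_eq_iff.2 hha.symm]
      refine mem_of_superset (Metric.isClosed_closedBall.isOpen_compl.mem_nhds ?_)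
        (compl_subset_compl.2 Metric.ball_subset_closedBall)
      rw [mem_compl_iff, Metric.mem_closedBall]
      linarith
    exact (continuous_const_smul h⁻¹).continuousAt.preimage_mem_nhds this
  have hNball : N ⊆ Metric.ball a δ := fun z hz => by simpa using hj _ hz
  have hNh : ∀ z ∈ N, h • z ∈ N := fun z hz => by
    have h1 := hNball hz
    rw [hNdef, mem_ofPred_eq, inv_smul_smul, Metric.mem_ball]
    rw [Metric.mem_ball] at h1
    have := dist_triangle_left a b z
    intro h2
    linarith
  have hNpow : ∀ (n : ℕ), ∀ z ∈ N, h ^ n • z ∈ N := fun n => by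
    induction n with
    | zero => intro z hz; simpa using hz
    | succ n ih => intro z hz; rw [pow_succ', mul_smul]; exact hNh _ (ih z hz)
  have hoN : o ∉ N := fun ho => by
    have := hNball ho
    rw [Metric.mem_ball] at this
    linarith
  have hhoN : h • o ∈ N := by
    rw [hNdef, mem_ofPred_eq, inv_smul_smul, Metric.mem_ball]
    linarith
  have hinv : ∀ n : ℕ, (h ^ n)⁻¹ • o ∉ N := fun n hn => by
    have := hNpow n _ hn
    rw [smul_inv_smul] at this
    exact hoN this
  have hdisj : Disjoint N (Metric.ball D.x δ ∪ Metric.ball b δ) := by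
    refine disjoint_left.2 fun z hz => ?_
    have h1 := hNball hz
    rw [Metric.mem_ball] at h1
    rintro (h2 | h2) <;> rw [Metric.mem_ball] at h2
    · have := dist_triangle_left a D.x z
      linarith
    · have := dist_triangle_left a b z
      linarith
  obtain ⟨M, hM⟩ := B.exists_norm_tsum_add_le (D.holderKernel f) hxy h0 hax
    (Metric.ball_mem_nhds D.x hδ) (Metric.ball_mem_nhds b hδ) hNa hdisj
  refine ⟨j, M, fun n => ?_⟩
  rw [← hh]
  have hhpow : ∀ c : X, h • c = c → h ^ n • c = c := fun c hc =>
    MulAction.mem_stabilizer_iff.1 (pow_mem (MulAction.mem_stabilizer_iff.2 hc) n)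
  obtain ⟨hs, hle⟩ := hM (h ^ n) (hhpow a hha) (hhpow b hhb)
  obtain ⟨F, hF⟩ : ∃ F : Γ → BoundedContinuousFunction X ℝ, F = fun k =>
      {k : Γ | k • o ∈ N}.indicator (fun k => legTerm (D.kernel f) k a b) k -
        {k : Γ | ((h ^ n)⁻¹ * k) • o ∈ N}.indicator (fun k => legTerm (D.kernel f) k a b) k :=
    ⟨_, rfl⟩
  rw [← hF] at hs hle
  have hsub : ∀ k : Γ, ((h ^ n)⁻¹ * k) • o ∈ N → k • o ∈ N := fun k hk => by
    have := hNpow n _ hk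
    rwa [← mul_smul, mul_inv_cancel_left] at this
  have hF0 : ∀ k, 0 ≤ D.mean (F k) := fun k => by
    simp only [hF, indicator, mem_ofPred_eq]
    by_cases h1 : ((h ^ n)⁻¹ * k) • o ∈ N
    · simp [h1, hsub k h1]
    · by_cases h2 : k • o ∈ N
      · simpa [h1, h2] using hpos k
      · simp [h1, h2]
  have hF1 : ∀ i < n, D.mean (F (h ^ (i + 1))) = D.mean (legTerm (D.kernel f) (1 : Γ) a b) := by
    intro i hi
    have h1 : h ^ (i + 1) • o ∈ N := by
      rw [pow_succ, mul_smul]; exact hNpow i _ hhoN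
    have h2 : ((h ^ n)⁻¹ * h ^ (i + 1)) • o ∉ N := by
      have : (h ^ n)⁻¹ * h ^ (i + 1) = (h ^ (n - (i + 1)))⁻¹ := by
        rw [inv_mul_eq_iff_eq_mul, eq_mul_inv_iff_mul_eq, ← pow_add]
        congr 1; omega
      rw [this]
      exact hinv _
    have h3 : legTerm (D.kernel f) (h ^ (i + 1)) a b = legTerm (D.kernel f) (1 : Γ) a b := by
      have hc : ∀ c : X, h • c = c → h ^ (i + 1) • c = c := fun c hc =>
        MulAction.mem_stabilizer_iff.1 (pow_mem (MulAction.mem_stabilizer_iff.2 hc) _)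
      have := legTerm_smul (H := D.kernel f) (h ^ (i + 1)) (h ^ (i + 1)) a b
      rwa [hc a hha, hc b hhb, inv_mul_cancel] at this
    simp only [hF, indicator, mem_ofPred_eq, h1, h2, if_true, if_false, sub_zero, h3]
  have hinj : Function.Injective fun i : ℕ => h ^ (i + 1) := by
    have key : ∀ i l : ℕ, i < l → h ^ (i + 1) ≠ h ^ (l + 1) := fun i l hil he => by
      have e : h ^ (l - i) = 1 := by
        have : h ^ (l + 1) = h ^ (i + 1) * h ^ (l - i) := by rw [← pow_add]; congr 1; omega
        rw [this] at he
        exact (mul_eq_left.1 he.symm)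
      have : h ^ (l - i) • o ∈ N := by
        obtain ⟨t, ht⟩ : ∃ t, l - i = t + 1 := ⟨l - i - 1, by omega⟩
        rw [ht, pow_succ, mul_smul]; exact hNpow t _ hhoN
      rw [e, one_smul] at this
      exact hoN this
    intro i l he
    rcases lt_trichotomy i l with hil | hil | hil
    · exact absurd he (key i l hil)
    · exact hil
    · exact absurd he.symm (key l i hil)
  classical
  have hsum : n * D.mean (legTerm (D.kernel f) (1 : Γ) a b) ≤ D.mean (∑' k, F k) := by
    rw [D.mean.map_tsum hs]
    have h1 := (D.mean.summable hs).sum_le_tsum ((Finset.range n).image fun i => h ^ (i + 1))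
      fun k _ => hF0 k
    rw [Finset.sum_image hinj.injOn, Finset.sum_congr rfl fun i hi => hF1 i (Finset.mem_range.1 hi),
      Finset.sum_const, Finset.card_range, nsmul_eq_mul] at h1
    exact h1
  have := (abs_le.1 ((D.abs_mean_le _).trans hle)).2
  rw [map_add] at this
  linarith

end Psi

end LeafDatum

/-! ### Construction of the data -/

section Data

theorem exists_holderWith_half {Y : Type*} [PseudoMetricSpace Y] [BoundedSpace Y] {F : Y → ℝ}
    (hF : LipschitzWith 1 F) : ∃ q : ℝ≥0, HolderWith q (1 / 2) F := by
  obtain ⟨B, hB⟩ := (Metric.isBounded_iff_nndist).1 (BoundedSpace.bounded_univ (α := Y))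
  refine ⟨_, (holderWith_one.2 hF).of_le (D := B) (fun x y => ?_) (by norm_num)⟩
  rw [edist_nndist]
  exact_mod_cast hB (mem_univ x) (mem_univ y)

/-- A Borel probability measure on an open set `W`: a convex combination of the point masses at a
dense sequence if `W` is separable, and a point mass otherwise. -/
theorem exists_measure {X : Type*} [MetricSpace X] [MeasurableSpace X] [BorelSpace X] {W : Set X}
    (hW : IsOpen W) (hne : W.Nonempty) :
    ∃ μ : Measure X, IsProbabilityMeasure μ ∧ μ Wᶜ = 0 ∧ (TopologicalSpace.IsSeparable W →
      ∀ O : Set X, O ⊆ W → IsOpen O → O.Nonempty → 0 < μ O) := by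
  by_cases hsep : TopologicalSpace.IsSeparable W
  · obtain ⟨t, htW, htc, hdense⟩ := hsep.exists_countable_dense_subset
    have htne : t.Nonempty := by
      rw [← closure_nonempty_iff]
      exact hne.mono hdense
    obtain ⟨w, rfl⟩ := htc.exists_eq_range htne
    have happ : ∀ O : Set X, MeasurableSet O →
        Measure.sum (fun n : ℕ => (2⁻¹ : ENNReal) ^ (n + 1) • Measure.dirac (w n)) O =
          ∑' n : ℕ, (2⁻¹ : ENNReal) ^ (n + 1) * O.indicator 1 (w n) := fun O hO => by
      rw [Measure.sum_apply _ hO]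
      refine tsum_congr fun n => ?_
      rw [Measure.smul_apply, Measure.dirac_apply' _ hO, smul_eq_mul]
    refine ⟨Measure.sum fun n : ℕ => (2⁻¹ : ENNReal) ^ (n + 1) • Measure.dirac (w n), ⟨?_⟩, ?_,
      fun _ O hOW hO hOne => ?_⟩
    · rw [happ _ MeasurableSet.univ]
      simp only [indicator_univ, Pi.one_apply, mul_one]
      rw [ENNReal.tsum_geometric_add_one, ENNReal.one_sub_inv_two, inv_inv]
      exact ENNReal.inv_mul_cancel (by simp) (by simp)
    · rw [happ _ hW.measurableSet.compl, ENNReal.tsum_eq_zero]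
      intro n
      rw [indicator_of_notMem (notMem_compl_iff.2 (htW (mem_range_self n))), mul_zero]
    · obtain ⟨y, hy⟩ := hOne
      obtain ⟨_, hz, n, rfl⟩ := mem_closure_iff.1 (hdense (hOW hy)) O hO hy
      rw [happ _ hO.measurableSet]
      refine lt_of_lt_of_le ?_ (ENNReal.le_tsum n)
      rw [indicator_of_mem hz, Pi.one_apply, mul_one]
      exact ENNReal.pow_pos (by simp) _
  · obtain ⟨z, hz⟩ := hne
    refine ⟨Measure.dirac z, inferInstance, ?_, fun h => absurd h hsep⟩
    rw [Measure.dirac_apply' _ hW.measurableSet.compl, indicator_of_notMem (notMem_compl_iff.2 hz)]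

variable {Γ X : Type*} [Group Γ] [MetricSpace X] [BoundedSpace X] [MulAction Γ X]
  [MeasurableSpace X]

/-- The distance to the complement of the box, as a Hölder function supported in the box. -/
theorem LeafDatum.infDist_mem_holderFunctions (D : LeafDatum Γ X) :
    (fun p => Metric.infDist p D.Cᶜ) ∈ D.holderFunctions := by
  obtain ⟨q, hq⟩ := exists_holderWith_half (Metric.lipschitz_infDist_pt (D.Cᶜ))
  exact ⟨Metric.continuous_infDist_pt _, fun p hp => Metric.infDist_zero_of_mem hp, q, 1 / 2,
    by norm_num, NNReal.half_lt_self one_ne_zero, hq.holderOnWith _⟩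

variable [ContinuousConstSMul Γ X] [BorelSpace X]

/-- For an element `g` with fixed points `a` and `b`, and finitely many elements `g' j` whose pairs
of fixed points have orbits that avoid `(a, b)` in both orders, there is a box about a triple
`(a, b, z)` for which the quasimorphisms are bounded on the powers of all the `g' j`, while one of
them grows linearly on the powers of some power of `g`. As the base point serves a fixed point
of one of the `g' j`, moved close to `a` by a power of `g`: its leaf to the other fixed point misses
all translates of the box. -/
theorem exists_leafDatum (hX : ∀ x : X, (𝓝[≠] x).NeBot) (hweak : WeaklyHyperbolic Γ X)
    (hproper : MetricallyProper Γ X) {g : Γ} {a b : X} (hg : NorthSouth g a b)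
    (hflip : ∀ γ : Γ, ¬ (γ • a = b ∧ γ • b = a)) {ι : Type*} [Finite ι] [Nonempty ι] {g' : ι → Γ}
    {a' b' : ι → X} (hg' : ∀ j, NorthSouth (g' j) (a' j) (b' j))
    (hne : ∀ (j : ι) (γ : Γ), ¬ (γ • a' j = a ∧ γ • b' j = b))
    (hne' : ∀ (j : ι) (γ : Γ), ¬ (γ • b' j = a ∧ γ • a' j = b)) :
    ∃ (D : LeafDatum Γ X) (Ψ : D.holderFunctions →ₗ[ℝ] quasimorphisms Γ),
      (∀ f, D.IsPsi f.1 (Ψ f).1) ∧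
      (∀ f j, ∃ M : ℝ, ∀ n : ℕ, |(Ψ f).1 (g' j ^ n)| ≤ M) ∧
      ∃ (f : D.holderFunctions) (j : ℕ) (M c : ℝ), 0 < c ∧
        ∀ n : ℕ, (Ψ f).1 ((g ^ j) ^ n) ≤ M - n * c := by
  have hab : a ≠ b := hg.1
  obtain ⟨z, hza, hzb⟩ := exists_ne_ne hX a b
  obtain ⟨ν, m, R, ε, β, r, hr, hν, hν2, hconst, hbox⟩ :=
    exists_hyperbolicBox hX hweak hproper hab hza hzb
  choose r₁ hr₁ hav₁ using fun j => exists_orbit_avoid hX hproper (hg' j) hab (hne j)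
  choose r₂ hr₂ hav₂ using fun j => exists_orbit_avoid hX hproper (hg' j).symm hab (hne' j)
  obtain ⟨r₃, hr₃, hav₃⟩ := exists_orbit_avoid hX hproper hg.symm hab
    fun γ h => hflip γ ⟨h.2, h.1⟩
  obtain ⟨s, ⟨⟨⟨hs1, hs2⟩, hs3⟩, hsr⟩, hs⟩ : ∃ s, ((((∀ j, s < r₁ j) ∧ ∀ j, s < r₂ j) ∧ s < r₃) ∧
      s < r) ∧ 0 < s := by
    have h : ∀ t : ℝ, 0 < t → ∀ᶠ s in 𝓝[>] (0 : ℝ), s < t := fun t ht =>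
      by
      filter_upwards [Ioo_mem_nhdsGT ht] with s hs using hs.2
    exact (((((eventually_all.2 fun j => h _ (hr₁ j)).and (eventually_all.2 fun j => h _ (hr₂ j))).and
      (h _ hr₃)).and (h _ hr)).and self_mem_nhdsWithin).exists
  obtain ⟨U, V, W, oU, oV, oW, haU, hbV, hzW, hUs, hVs, hWs, hembed, hfin⟩ :=
    hproper.exists_embedded_box hab hza hzb hflip hs
  have hsub : ∀ y : X, Metric.ball y s ⊆ Metric.ball y r := fun y => Metric.ball_subset_ball hsr.le
  obtain ⟨sUV, sUW, sVW, hdiam, hhyp⟩ := hbox U V W oU oV (hUs.trans (hsub a)) (hVs.trans (hsub b))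
    (hWs.trans (hsub z))
  have hmiss : ∀ (j : ι) (γ : Γ), ¬ (γ • a' j ∈ U ∧ γ • b' j ∈ V) := fun j γ h =>
    hav₁ j γ ⟨lt_trans (hUs h.1) (hs1 j), lt_trans (hVs h.2) (hs1 j)⟩
  have hmiss' : ∀ (j : ι) (γ : Γ), ¬ (γ • b' j ∈ U ∧ γ • a' j ∈ V) := fun j γ h =>
    hav₂ j γ ⟨lt_trans (hUs h.1) (hs2 j), lt_trans (hVs h.2) (hs2 j)⟩
  have hmissba : ∀ γ : Γ, ¬ (γ • b ∈ U ∧ γ • a ∈ V) := fun γ h =>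
    hav₃ γ ⟨lt_trans (hUs h.1) hs3, lt_trans (hVs h.2) hs3⟩
  -- One of the two fixed points of `g' j₀` differs from both `a` and `b`.
  obtain ⟨j₀⟩ := ‹Nonempty ι›
  obtain ⟨p, q, hpq, hpa, hpb, hp1, hp2⟩ : ∃ p q : X, p ≠ q ∧ p ≠ a ∧ p ≠ b ∧
      (∀ γ : Γ, ¬ (γ • p ∈ U ∧ γ • q ∈ V)) ∧ ∀ γ : Γ, ¬ (γ • q ∈ U ∧ γ • p ∈ V) := by
    by_cases h : a' j₀ ≠ a ∧ a' j₀ ≠ b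
    · exact ⟨a' j₀, b' j₀, (hg' j₀).1, h.1, h.2, hmiss j₀, hmiss' j₀⟩
    · refine ⟨b' j₀, a' j₀, (hg' j₀).1.symm, ?_, ?_, hmiss' j₀, hmiss j₀⟩
      · intro hb
        by_cases ha : a' j₀ = b
        · exact hne' j₀ 1 (by simp [ha, hb])
        · exact h ⟨fun h' => (hg' j₀).1 (h'.trans hb.symm), ha⟩
      · intro hb
        by_cases ha : a' j₀ = a
        · exact hne j₀ 1 (by simp [ha, hb])
        · exact h ⟨ha, fun h' => (hg' j₀).1 (h'.trans hb.symm)⟩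
  obtain ⟨k, hkU⟩ : ∃ k : ℕ, g ^ k • p ∈ U := by
    obtain ⟨t, ht, htU⟩ := Metric.mem_nhds_iff.1 (oU.mem_nhds haU)
    have hd : 0 < dist p b := dist_pos.2 hpb
    obtain ⟨k, -, hk, -⟩ := hg.2.2.2.1 (min t (dist p b)) (lt_min ht hd)
    refine ⟨k, htU (Metric.ball_subset_ball (min_le_left _ _) (hk p ?_))⟩
    rw [Metric.mem_ball, not_lt]
    exact min_le_right _ _
  have hfixa : g ^ k • a = a :=
    MulAction.mem_stabilizer_iff.1 (pow_mem (MulAction.mem_stabilizer_iff.2 hg.2.1) k)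
  obtain ⟨μ, hprob, hμW, hμopen⟩ := exists_measure oW ⟨z, hzW⟩
  have hbaC : (b, a) ∉ U ×ˢ V := fun h => hmissba 1 (by simpa using h)
  have hcompl : ((U ×ˢ V)ᶜ : Set (X × X)).Nonempty := ⟨(b, a), hbaC⟩
  obtain ⟨q₀, hq₀⟩ := exists_holderWith_half
    (F := fun p => min 1 (Metric.infDist p ((U ×ˢ V)ᶜ : Set (X × X))))
    ((Metric.lipschitz_infDist_pt _).const_min 1)
  have hψab : 0 < min 1 (Metric.infDist (a, b) ((U ×ˢ V)ᶜ : Set (X × X))) := by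
    refine lt_min one_pos (((oU.prod oV).isClosed_compl.notMem_iff_infDist_pos hcompl).1 ?_)
    exact fun h => h ⟨haU, hbV⟩
  let D : LeafDatum Γ X :=
    { ν := ν, m := m, R := R, ν_pos := hν, ν_lt := hν2, constants := hconst
      U := U, V := V, W := W, isOpen_U := oU, isOpen_V := oV, isOpen_W := oW
      sep_UV := sUV, sep_UW := sUW, sep_VW := sVW, diam_lt := hdiam, embeds := hembed
      μ := μ, prob := hprob, μ_compl := hμW, μ_open := hμopen
      ψ := fun p => min 1 (Metric.infDist p ((U ×ˢ V)ᶜ : Set (X × X)))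
      ψ_mem := fun p => ⟨le_min zero_le_one Metric.infDist_nonneg, min_le_left _ _⟩
      ψ_supp := fun p hp => by
        rw [Metric.infDist_zero_of_mem (by exact hp), min_eq_right zero_le_one]
      ψ_ne := fun h => hψab.ne' (congrFun h (a, b))
      ψ_holder := ⟨q₀, 1 / 2, by norm_num, NNReal.half_lt_self one_ne_zero, hq₀⟩
      x := g ^ k • p, x_mem := hkU }
  have B : HyperbolicBox Γ D.U D.V z ε β ν m := hhyp z hzW
  have hxy : D.x ≠ g ^ k • q := fun h => hpq (smul_left_cancel _ h)
  have h0 : ∀ (f : D.holderFunctions) (l : Γ), legTerm (D.kernel f) l D.x (g ^ k • q) = 0 :=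
    fun f l => D.legTerm_kernel_eq_zero
      (fun γ h => hp1 (γ * g ^ k) (by rw [mul_smul, mul_smul]; exact h))
      (fun γ h => hp2 (γ * g ^ k) (by rw [mul_smul, mul_smul]; exact h)) f l
  obtain ⟨Ψ, hΨ, hΨeq⟩ := D.exists_psi B hxy h0
  have hcard : 0 < (Nat.card (fixingSubgroup Γ (D.U ∪ D.V ∪ D.W)) : ℝ)⁻¹ := by
    have : Finite (fixingSubgroup Γ (D.U ∪ D.V ∪ D.W)) := hfin
    exact inv_pos.2 (Nat.cast_pos.2 Nat.card_pos)
  have hCne : D.Cᶜ.Nonempty := ⟨(b, a, z), fun h => hbaC ⟨h.1, h.2.1⟩⟩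
  refine ⟨D, Ψ, hΨ, fun f j => ?_, ⟨_, D.infDist_mem_holderFunctions⟩, ?_⟩
  · obtain ⟨M, hM⟩ := D.exists_abs_mean_pow_le B hxy f (h0 f) (hg' j).1 (hg' j).2.1 (hg' j).2.2.1
      (D.legTerm_kernel_eq_zero (hmiss j) (hmiss' j) f)
    refine ⟨(Nat.card (fixingSubgroup Γ (D.U ∪ D.V ∪ D.W)) : ℝ)⁻¹ * M, fun n => ?_⟩
    rw [hΨeq, abs_mul, abs_of_pos hcard]
    exact mul_le_mul_of_nonneg_left (hM n) hcard.le
  · set f : D.holderFunctions := ⟨_, D.infDist_mem_holderFunctions⟩ with hf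
    have hterm : ∀ l : Γ, legTerm (D.kernel f) l a b = D.kernel f (l⁻¹ • a) (l⁻¹ • b) := fun l => by
      rw [legTerm, (D.holderKernel f).supp (l⁻¹ • b) _ (hmissba l⁻¹), sub_zero]
    have hker : ∀ u v w, 0 ≤ D.kernel f u v w := fun u v w =>
      mul_nonneg (D.ψ_mem _).1 Metric.infDist_nonneg
    have hpos : ∀ l : Γ, 0 ≤ D.mean (legTerm (D.kernel f) l a b) := fun l => by
      rw [hterm, D.mean_apply]
      exact integral_nonneg (hker _ _)
    have hpos1 : 0 < D.mean (legTerm (D.kernel f) (1 : Γ) a b) := by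
      rw [hterm, D.mean_apply, inv_one, one_smul, one_smul,
        integral_pos_iff_support_of_nonneg (hker a b) (BoundedContinuousFunction.integrable _ _)]
      have hWsupp : W ⊆ Function.support (D.kernel f a b) := fun w hw => by
        refine (mul_pos hψab ?_).ne'
        refine (((oU.prod (oV.prod oW)).isClosed_compl).notMem_iff_infDist_pos hCne).1 ?_
        exact fun h => h ⟨haU, hbV, hw⟩
      refine lt_of_lt_of_le (pos_iff_ne_zero.2 fun hW0 => ?_) (measure_mono hWsupp)
      have := measure_union_le (μ := μ) W Wᶜ
      have hW0' : μ W = 0 := hW0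
      rw [union_compl_self, measure_univ, hW0', hμW, add_zero] at this
      exact absurd this (by simp)
    have hax : a ≠ D.x := fun h => hpa (smul_left_cancel (g ^ k) (h.symm.trans hfixa.symm))
    obtain ⟨j, M, hM⟩ := D.exists_mean_pow_le B hxy f (h0 f) hg hax hza hzb hpos
    refine ⟨j, (Nat.card (fixingSubgroup Γ (D.U ∪ D.V ∪ D.W)) : ℝ)⁻¹ * M, _,
      mul_pos hcard hpos1, fun n => ?_⟩
    rw [hΨeq]
    refine (mul_le_mul_of_nonneg_left (hM n) hcard.le).trans (le_of_eq ?_)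
    ring

end Data

/-! ### Classes of quasimorphisms in bounded cohomology -/

section Classes

variable {Γ : Type*}

theorem coboundary_two_apply (c : (Fin 2 → Γ) → ℝ) (t : Fin 3 → Γ) :
    coboundary Γ 2 c t = c ![t 1, t 2] - c ![t 0, t 2] + c ![t 0, t 1] := by
  have e0 : (fun j => t ((0 : Fin 3).succAbove j)) = ![t 1, t 2] := by
    funext j; fin_cases j <;> rfl
  have e1 : (fun j => t ((1 : Fin 3).succAbove j)) = ![t 0, t 2] := by
    funext j; fin_cases j <;> rfl
  have e2 : (fun j => t ((2 : Fin 3).succAbove j)) = ![t 0, t 1] := by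
    funext j; fin_cases j <;> rfl
  change ∑ i : Fin 3, (-1 : ℝ) ^ (i : ℕ) * c (fun j => t (i.succAbove j)) = _
  rw [Fin.sum_univ_three, e0, e1, e2]
  simp
  ring

variable [Group Γ]

/-- The cocycle of a quasimorphism `φ` is the coboundary of the cochain `(g, h) ↦ φ (g⁻¹ h)`. -/
theorem comparison_qmClass (φ : quasimorphisms Γ) : comparison Γ (qmClass Γ φ) = 0 := by
  change Submodule.mapQ _ _ _ _ (Submodule.Quotient.mk (qmCocycle Γ φ)) = 0
  rw [Submodule.mapQ_apply, Submodule.Quotient.mk_eq_zero, Submodule.submoduleOf,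
    Submodule.mem_comap]
  refine ⟨fun t => φ.1 ((t 0)⁻¹ * t 1), fun g t => by simp [mul_assoc], ?_⟩
  funext t
  rw [coboundary_two_apply]
  change _ = φ.1 ((t 0)⁻¹ * t 1) + φ.1 ((t 1)⁻¹ * t 2) - φ.1 ((t 0)⁻¹ * t 2)
  simp
  ring

/-- A quasimorphism with trivial class is the sum of a bounded function and a homomorphism. -/
theorem exists_hom_of_qmClass_eq_zero {φ : quasimorphisms Γ} (h : qmClass Γ φ = 0) :
    ∃ χ : Γ →* Multiplicative ℝ, ∃ M : ℝ, ∀ g, |φ.1 g - (χ g).toAdd| ≤ M := by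
  change (Submodule.Quotient.mk (qmCocycle Γ φ) : Hb2 Γ) = 0 at h
  rw [Submodule.Quotient.mk_eq_zero, Submodule.submoduleOf,
    Submodule.mem_comap] at h
  obtain ⟨c, ⟨hinv, M, hM⟩, hc⟩ := h
  have hadd : ∀ g h : Γ, φ.1 (g * h) - c ![1, g * h] =
      (φ.1 g - c ![1, g]) + (φ.1 h - c ![1, h]) := fun g h => by
    have h1 := congrFun hc ![1, g, g * h]
    rw [coboundary_two_apply] at h1
    change _ = φ.1 ((1 : Γ)⁻¹ * g) + φ.1 (g⁻¹ * (g * h)) - φ.1 ((1 : Γ)⁻¹ * (g * h)) at h1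
    have h2 := hinv g ![1, h]
    have e : (fun i => g * (![1, h] : Fin 2 → Γ) i) = ![g, g * h] := by
      funext i; fin_cases i <;> simp
    rw [e] at h2
    simp only [inv_one, one_mul, inv_mul_cancel_left] at h1
    simp at h1
    linarith
  refine ⟨MonoidHom.mk' (fun g => Multiplicative.ofAdd (φ.1 g - c ![1, g])) fun g h => ?_, M,
    fun g => ?_⟩
  · rw [hadd, ofAdd_add]
  · simpa using hM ![1, g]

/-- The homomorphism from a free group of rank two to the real line with prescribed values on the
generators, transported to a subgroup `G` and extended by zero. It depends linearly on the
prescribed values. -/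
def freeHom {G : Subgroup Γ} (e : G ≃* FreeGroup (Fin 2)) : (Fin 2 → ℝ) →ₗ[ℝ] (Γ → ℝ) := by
  classical
  exact
  { toFun := fun c γ => if h : γ ∈ G then
      (FreeGroup.lift (fun s => Multiplicative.ofAdd (c s)) (e ⟨γ, h⟩)).toAdd else 0
    map_add' := fun c c' => by
      funext γ
      simp only [Pi.add_apply]
      by_cases h : γ ∈ G
      · simp only [h, dif_pos]
        induction e ⟨γ, h⟩ using FreeGroup.induction_on with
        | C1 => simp
        | of s => simp
        | inv_of s ih => simp only [map_inv, toAdd_inv, ih]; ring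
        | mul x y hx hy => simp only [map_mul, toAdd_mul, hx, hy]; ring
      · simp [h]
    map_smul' := fun r c => by
      funext γ
      simp only [Pi.smul_apply, smul_eq_mul, RingHom.id_apply]
      by_cases h : γ ∈ G
      · simp only [h, dif_pos]
        induction e ⟨γ, h⟩ using FreeGroup.induction_on with
        | C1 => simp
        | of s => simp
        | inv_of s ih => simp only [map_inv, toAdd_inv, ih]; ring
        | mul x y hx hy => simp only [map_mul, toAdd_mul, hx, hy]; ring
      · simp [h] }

theorem exists_freeHom_eq {G : Subgroup Γ} (e : G ≃* FreeGroup (Fin 2))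
    (χ : Γ →* Multiplicative ℝ) :
    ∃ c : Fin 2 → ℝ, ∀ γ ∈ G, freeHom e c γ = (χ γ).toAdd := by
  refine ⟨fun s => (χ (e.symm (FreeGroup.of s))).toAdd, fun γ hγ => ?_⟩
  have h : FreeGroup.lift (fun s => Multiplicative.ofAdd (χ (e.symm (FreeGroup.of s))).toAdd) =
      (χ.comp G.subtype).comp e.symm.toMonoidHom := by
    ext s; simp
  simp only [freeHom, LinearMap.coe_mk, AddHom.coe_mk, dif_pos hγ, h]
  simp

/-- Functions that are bounded on a subgroup. -/
def boundedOn (G : Subgroup Γ) : Submodule ℝ (Γ → ℝ) where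
  carrier := {F | ∃ M : ℝ, ∀ g ∈ G, |F g| ≤ M}
  add_mem' {F F'} hF hF' := by
    obtain ⟨M, hM⟩ := hF
    obtain ⟨M', hM'⟩ := hF'
    exact ⟨M + M', fun g hg => (abs_add_le _ _).trans (add_le_add (hM g hg) (hM' g hg))⟩
  zero_mem' := ⟨0, fun g _ => by simp⟩
  smul_mem' a F hF := by
    obtain ⟨M, hM⟩ := hF
    refine ⟨|a| * M, fun g hg => ?_⟩
    simpa [abs_mul] using mul_le_mul_of_nonneg_left (hM g hg) (abs_nonneg a)

/-- A combination of the `φ i` that is bounded on `G` is trivial if `φ i` is bounded on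
the powers of `g j` for `j < i`, and unbounded on the powers of `g i`. -/
theorem eq_zero_of_mem_boundedOn {G : Subgroup Γ} {φ : ℕ → Γ → ℝ} {g : ℕ → Γ}
    (hg : ∀ i, g i ∈ G) (hlow : ∀ i j, j < i → ∃ M : ℝ, ∀ n : ℕ, |φ i (g j ^ n)| ≤ M)
    (hdiag : ∀ i, ∃ (j : ℕ) (M c : ℝ), 0 < c ∧ ∀ n : ℕ, φ i ((g i ^ j) ^ n) ≤ M - n * c)
    {N : ℕ} (r : Fin N → ℝ) (hr : ∑ i, r i • φ i ∈ boundedOn G) : r = 0 := by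
  obtain ⟨M₀, hM₀⟩ := hr
  have key : ∀ (k : ℕ) (hk : k < N), r ⟨k, hk⟩ = 0 := by
    intro k
    induction k using Nat.strong_induction_on with
    | _ k ih =>
      intro hk
      by_contra hne
      choose! M hM using hlow
      obtain ⟨j, M₁, c, hc, h₁⟩ := hdiag k
      have hbound : ∀ n : ℕ, |r ⟨k, hk⟩| * |φ k ((g k ^ j) ^ n)| ≤
          M₀ + ∑ i ∈ Finset.univ.erase (⟨k, hk⟩ : Fin N), |r i| * |M i k| := by
        intro n
        have hmem : (g k ^ j) ^ n ∈ G := pow_mem (pow_mem (hg k) j) n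
        have h2 := hM₀ _ hmem
        rw [Finset.sum_apply, ← Finset.add_sum_erase _ _ (Finset.mem_univ (⟨k, hk⟩ : Fin N))] at h2
        simp only [Pi.smul_apply, smul_eq_mul] at h2
        have h3 : |∑ i ∈ Finset.univ.erase (⟨k, hk⟩ : Fin N), r i * φ i ((g k ^ j) ^ n)| ≤
            ∑ i ∈ Finset.univ.erase (⟨k, hk⟩ : Fin N), |r i| * |M i k| := by
          refine (Finset.abs_sum_le_sum_abs _ _).trans (Finset.sum_le_sum fun i hi => ?_)
          rw [abs_mul]
          have hik : (i : ℕ) ≠ k := fun h => (Finset.mem_erase.1 hi).1 (Fin.ext h)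
          rcases lt_or_gt_of_ne hik with hlt | hgt
          · rw [show r i = 0 from ih i hlt i.2]
            simp
          · refine mul_le_mul_of_nonneg_left ?_ (abs_nonneg _)
            rw [← pow_mul]
            exact (hM i k hgt _).trans (le_abs_self _)
        rw [← abs_mul]
        have h4 := abs_sub_abs_le_abs_sub (r ⟨k, hk⟩ * φ k ((g k ^ j) ^ n))
          (-∑ i ∈ Finset.univ.erase (⟨k, hk⟩ : Fin N), r i * φ i ((g k ^ j) ^ n))
        rw [sub_neg_eq_add, abs_neg] at h4
        linarith
      set S := M₀ + ∑ i ∈ Finset.univ.erase (⟨k, hk⟩ : Fin N), |r i| * |M i k|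
      have hr0 : 0 < |r ⟨k, hk⟩| := abs_pos.2 hne
      obtain ⟨n, hn⟩ := exists_nat_gt ((S / |r ⟨k, hk⟩| + M₁) / c)
      rw [div_lt_iff₀ hc] at hn
      have h5 := h₁ n
      have h6 := neg_abs_le (φ k ((g k ^ j) ^ n))
      have h7 : S / |r ⟨k, hk⟩| < |φ k ((g k ^ j) ^ n)| := by linarith
      rw [div_lt_iff₀' hr0] at h7
      exact absurd (hbound n) (not_le.2 h7)
  funext i
  exact key i i.2

/-- Under the same hypotheses, if `G` is free of rank two, the classes of the `φ i` span an infinite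
dimensional space: a finite-dimensional span would leave a space of relations of dimension
greater than two, but a relation is determined by a homomorphism from `G` to the real line. -/
theorem not_finiteDimensional_of_qmClass_mem {G : Subgroup Γ} (e : G ≃* FreeGroup (Fin 2))
    {φ : ℕ → quasimorphisms Γ} {g : ℕ → Γ} (hg : ∀ i, g i ∈ G)
    (hlow : ∀ i j, j < i → ∃ M : ℝ, ∀ n : ℕ, |(φ i).1 (g j ^ n)| ≤ M)
    (hdiag : ∀ i, ∃ (j : ℕ) (M c : ℝ), 0 < c ∧ ∀ n : ℕ, (φ i).1 ((g i ^ j) ^ n) ≤ M - n * c)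
    {S : Submodule ℝ (Hb2 Γ)} (hS : ∀ i, qmClass Γ (φ i) ∈ S) : ¬ FiniteDimensional ℝ S := by
  intro hfin
  -- Relations among this many classes form a space of dimension at least `3 > 2`.
  set N := Module.finrank ℝ S + 3 with hN
  let T : (Fin N → ℝ) →ₗ[ℝ] S :=
    Fintype.linearCombination ℝ fun i : Fin N => (⟨qmClass Γ (φ i), hS i⟩ : S)
  let A : (Fin N → ℝ) →ₗ[ℝ] quasimorphisms Γ :=
    Fintype.linearCombination ℝ fun i : Fin N => φ i
  let L : (Fin N → ℝ) →ₗ[ℝ] (Γ → ℝ) ⧸ boundedOn G :=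
    (boundedOn G).mkQ ∘ₗ (quasimorphisms Γ).subtype ∘ₗ A
  let F : (Fin 2 → ℝ) →ₗ[ℝ] (Γ → ℝ) ⧸ boundedOn G := (boundedOn G).mkQ ∘ₗ freeHom e
  have hA : ∀ r, (A r).1 = ∑ i, r i • (φ i).1 := fun r => by
    simp [A, Fintype.linearCombination_apply]
  have hLinj : ∀ r, L r = 0 → r = 0 := fun r hr => by
    change Submodule.Quotient.mk (A r).1 = 0 at hr
    rw [Submodule.Quotient.mk_eq_zero, hA] at hr
    exact eq_zero_of_mem_boundedOn (φ := fun i => (φ i).1) hg hlow hdiag r hr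
  have hLF : ∀ r ∈ LinearMap.ker T, L r ∈ LinearMap.range F := fun r hr => by
    have h0 : qmClass Γ (A r) = 0 := by
      have := congrArg Subtype.val (LinearMap.mem_ker.1 hr)
      simpa [T, A, Fintype.linearCombination_apply] using this
    obtain ⟨χ, M, hM⟩ := exists_hom_of_qmClass_eq_zero h0
    obtain ⟨c, hc⟩ := exists_freeHom_eq e χ
    refine ⟨c, (Submodule.Quotient.eq _).2 ⟨M, fun γ hγ => ?_⟩⟩
    rw [Pi.sub_apply, hc γ hγ, abs_sub_comm]
    exact hM γ
  have h1 := LinearMap.finrank_range_add_finrank_ker T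
  have h2 : Module.finrank ℝ (LinearMap.range T) ≤ Module.finrank ℝ S := Submodule.finrank_le _
  have h3 : Module.finrank ℝ (LinearMap.ker T) ≤ Module.finrank ℝ (LinearMap.range F) := by
    refine LinearMap.finrank_le_finrank_of_injective
      (f := (L.domRestrict (LinearMap.ker T)).codRestrict _ fun r => hLF r.1 r.2) ?_
    rw [← LinearMap.ker_eq_bot, LinearMap.ker_eq_bot']
    intro r hr
    exact Subtype.ext (hLinj r.1 (congrArg Subtype.val hr))
  have h4 := F.finrank_range_le
  rw [Module.finrank_fin_fun] at h1 h4
  omega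

end Classes

end LeafQuasi

end

open LeafQuasi in
theorem proposition3p2 {Γ X : Type*} [Group Γ] [Countable Γ] [MetricSpace X] [BoundedSpace X]
    [MeasurableSpace X] [BorelSpace X] [MulAction Γ X] [ContinuousConstSMul Γ X]
    (hX : ∀ x : X, (𝓝[≠] x).NeBot)
    (hweak : WeaklyHyperbolic Γ X)
    (hproper : MetricallyProper Γ X)
    (G : Subgroup Γ) (hG : Nonempty (G ≃* FreeGroup (Fin 2)))
    (hNS : ∀ g ∈ G, g ≠ 1 → ∃ a b : X, NorthSouth g a b)
    (horbit : ∃ (g : ℕ → Γ) (a b : ℕ → X),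
      (∀ i, g i ∈ G ∧ NorthSouth (g i) (a i) (b i)) ∧
      (∀ i j, i ≠ j → ∀ γ : Γ, ¬ (γ • a i = a j ∧ γ • b i = b j)) ∧
      (∀ i j, ∀ γ : Γ, ¬ (γ • a i = b j ∧ γ • b i = a j))) :
    ∃ (D : ℕ → LeafDatum Γ X) (Ψ : ∀ i, (D i).holderFunctions →ₗ[ℝ] quasimorphisms Γ),
      (∀ i f, (D i).IsPsi f.1 (Ψ i f).1) ∧
      (⨆ i, LinearMap.range ((qmClass Γ).comp (Ψ i))) ≤ LinearMap.ker (comparison Γ) ∧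
      ¬ FiniteDimensional ℝ ↥(⨆ i, LinearMap.range ((qmClass Γ).comp (Ψ i))) := by
  obtain ⟨g, a, b, hg, hdisj, hflip⟩ := horbit
  obtain ⟨e⟩ := hG
  have hdata : ∀ i : ℕ, ∃ (D : LeafDatum Γ X) (Ψ : D.holderFunctions →ₗ[ℝ] quasimorphisms Γ),
      (∀ f, D.IsPsi f.1 (Ψ f).1) ∧
      (∀ f (j : {j : ℕ // j ≤ i + 1 ∧ j ≠ i}), ∃ M : ℝ, ∀ n : ℕ, |(Ψ f).1 (g j ^ n)| ≤ M) ∧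
      ∃ (f : D.holderFunctions) (j : ℕ) (M c : ℝ), 0 < c ∧
        ∀ n : ℕ, (Ψ f).1 ((g i ^ j) ^ n) ≤ M - n * c := fun i => by
    have : Finite {j : ℕ // j ≤ i + 1 ∧ j ≠ i} :=
      ((finite_Iic (i + 1)).subset fun j hj => hj.1).to_subtype
    have : Nonempty {j : ℕ // j ≤ i + 1 ∧ j ≠ i} := ⟨⟨i + 1, le_rfl, by omega⟩⟩
    exact exists_leafDatum hX hweak hproper (hg i).2 (hflip i i) (fun j => (hg j).2)
      (fun j => hdisj j i j.2.2) fun j γ h => hflip j i γ ⟨h.2, h.1⟩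
  choose D Ψ hΨ hlow f hdiag using hdata
  refine ⟨D, Ψ, hΨ, iSup_le fun i => ?_, ?_⟩
  · rintro _ ⟨f, rfl⟩
    exact comparison_qmClass _
  · refine not_finiteDimensional_of_qmClass_mem e (φ := fun i => Ψ i (f i)) (fun i => (hg i).1)
      (fun i j hji => hlow i (f i) ⟨j, by omega, by omega⟩) hdiag fun i => ?_
    exact Submodule.mem_iSup_of_mem i ⟨f i, rfl⟩
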